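/- Let $A$ be a unital C*-algebra and $I$ a countable set. Let $\ell^2(I)\otimes A$ be the standard right Hilbert $A$-module with vectors $\delta_i\otimes 1$ ($i\in I$), let $C:=\mathrm{End}^\dagger(\ell^2(I)\otimes A)$ be its C*-algebra of adjointable operators (it contains $A\otimes B(\ell^2(I))$, the closed span of the operators $a\otimes x$), and let $1\otimes e_{ij}\in C$ be the matrix units. Let $\eta\colon A\to C$ be a covariance matrix, i.e. a completely positive map (in particular, any completely positive $\eta\colon A\to A\otimes B(\ell^2(I))$ is allowed), and write $\eta_{ij}(a)=\langle \delta_i\otimes 1\mid \eta(a)(\delta_j\otimes 1)\rangle_A$ for its entries, so that $\eta=\sum_{i,j}\eta_{ij}\otimes e_{ij}$ formally. For a completely positive map $\theta\colon A\to D$ of unital C*-algebras let $A\otimes_\theta D$ denote the right $A$-$D$ C*-correspondence obtained from the algebraic tensor product $A\odot D$ by separation and completion for $\langle a_1\otimes d_1\mid a_2\otimes d_2\rangle_D=d_1^*\theta(a_1^*a_2)d_2$. Fix $i_0\in I$ and let $T:=(A\otimes_\eta C)\lhd(1\otimes e_{i_0i_0})$, a right $A$-$A$ C*-correspondence with inner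 product $\langle \xi\mid\zeta\rangle_A=(1\otimes \mathrm{Tr})(\langle\xi\mid\zeta\rangle_C)$ (which is the $(i_0,i_0)$ entry of $\langle\xi\mid\zeta\rangle_C$), and let $\xi_i:=[1\otimes(1\otimes e_{ii_0})]\in T$. Let $\mathcal F(T)=\overline{\bigoplus_{d\ge 0}}\,T^{\boxtimes_A d}$ with $T^{\boxtimes_A 0}=A$ be the Fock space, $\hat 1\in T^{\boxtimes_A 0}$ the copy of $1\in A$, and $\ell(\xi)\in\mathrm{End}^\dagger(\mathcal F(T)_A)$ the creation operator of $\xi\in T$, $\ell(\xi)\zeta=\xi\boxtimes\zeta$. Put $X_i:=\ell(\xi_i)+\ell(\xi_i)^*$ and let $\hat\Phi(A,\eta)\subset\mathrm{End}^\dagger(\mathcal F(T)_A)$ be the C*-algebra generated by $A$ (acting on the left) and $\{X_i: i\in I\}$. Let $E\colon\hat\Phi(A,\eta)\to A$, $E(x):=\langle\hat 1\mid x\hat 1\rangle_A$, and assume that $E$ is faithful, i.e. $E(x^*x)=0$ implies $x=0$. Let $\mathcal B$ be the right $\hat\Phi(A,\eta)$-$A$ C*-correspondence obtained by completing $\hat\Phi(A,\eta)\Omega$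 for $\langle x\Omega\mid y\Omega\rangle_A:=E(x^*y)$, with left and right actions given by multiplication. Then $x\Omega\mapsto x\hat 1$ extends to an isometric isomorphism $\mathcal B\cong\mathcal F(T)$ of right $\hat\Phi(A,\eta)$-$A$ C*-correspondences. In particular, for every $i\in I$, $$\overline{A\rhd X_i\Omega\lhd A}\;\cong\;\overline{A\rhd\xi_i\lhd A}\;\cong\;A\otimes_{\eta_{ii}}A$$ as right $A$-$A$ C*-correspondences, where $\overline{A\rhd v\lhd A}$ denotes the closed linear span of $\{a\rhd v\lhd b: a,b\in A\}$ in $\mathcal B$, respectively in $T$. -/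

import Mathlib

open UniformSpace TensorProduct
open scoped CStarAlgebra

universe u

namespace CStarCorr

noncomputable section

/-! ### Pre-Hilbert modules, Hilbert modules -/

/-- A semi-inner-product right module over the C*-algebra `A`. Inner products are conjugate linear
in the first variable. Algebraic laws of the right action are not required here: they hold
automatically after separation. -/
structure PreHilbertModule (A : Type u) [CStarAlgebra A] [PartialOrder A] [StarOrderedRing A] where
  carrier : Type u
  [addCommGroup : AddCommGroup carrier]
  [module : Module ℂ carrier]
  form : carrier →ₗ⋆[ℂ] carrier →ₗ[ℂ] A
  star_form : ∀ x y, star (form x y) = form y x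
  form_self_nonneg : ∀ x, 0 ≤ form x x
  ract : A → carrier →ₗ[ℂ] carrier
  form_ract : ∀ x y a, form x (ract a y) = form x y * a

/-- A (right) Hilbert C*-module over `A`. (Mathlib's `CStarModule` has the scalars on the left.)
The laws `x ◁ (a b) = (x ◁ a) ◁ b`, `x ◁ 1 = x` and additivity in `a` are consequences,
see `ract_mul`, `ract_one`, `ract_add` below. -/
structure HilbertModule (A : Type u) [CStarAlgebra A] [PartialOrder A] [StarOrderedRing A] where
  carrier : Type u
  [normedAddCommGroup : NormedAddCommGroup carrier]
  [normedSpace : NormedSpace ℂ carrier]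
  [completeSpace : CompleteSpace carrier]
  /-- the `A`-valued inner product `⟨x | y⟩_A` -/
  ip : carrier →ₗ⋆[ℂ] carrier →ₗ[ℂ] A
  star_ip : ∀ x y, star (ip x y) = ip y x
  ip_self_nonneg : ∀ x, 0 ≤ ip x x
  norm_sq : ∀ x, ‖x‖ ^ 2 = ‖ip x x‖
  /-- the right action, `ract a x = x ◁ a` -/
  ract : A → carrier →ₗ[ℂ] carrier
  ip_ract : ∀ x y a, ip x (ract a y) = ip x y * a

variable {A : Type u} [CStarAlgebra A] [PartialOrder A] [StarOrderedRing A]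

instance : CoeSort (PreHilbertModule A) (Type u) := ⟨PreHilbertModule.carrier⟩
instance (P : PreHilbertModule A) : AddCommGroup P := P.addCommGroup
instance (P : PreHilbertModule A) : Module ℂ P := P.module

instance : CoeSort (HilbertModule A) (Type u) := ⟨HilbertModule.carrier⟩
instance (E : HilbertModule A) : NormedAddCommGroup E := E.normedAddCommGroup
instance (E : HilbertModule A) : NormedSpace ℂ E := E.normedSpace
instance (E : HilbertModule A) : CompleteSpace E := E.completeSpace

namespace PreHilbertModule

variable (P : PreHilbertModule A)

lemma ract_form (x y : P) (a : A) : P.form (P.ract a x) y = star a * P.form x y := by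
  rw [← P.star_form, P.form_ract, star_mul, P.star_form]

/-- Cauchy-Schwarz inequality, semidefinite case. -/
lemma norm_form_sq_le (x y : P) : ‖P.form x y‖ ^ 2 ≤ ‖P.form x x‖ * ‖P.form y y‖ := by
  have key : ∀ c : ℝ, ‖P.form x x‖ ≤ c → 0 < c → ‖P.form x y‖ ^ 2 ≤ c * ‖P.form y y‖ := by
    intro c hc hc0
    set g := P.form x y with hg
    have h1 : 0 ≤ P.form ((c : ℂ) • y - P.ract g x) ((c : ℂ) • y - P.ract g x) :=
      P.form_self_nonneg _
    have h2 : P.form ((c : ℂ) • y - P.ract g x) ((c : ℂ) • y - P.ract g x) =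
        (c : ℂ) • ((c : ℂ) • P.form y y) - (c : ℂ) • (star g * g) - (c : ℂ) • (star g * g)
          + star g * P.form x x * g := by
      have hyx : P.form y x = star g := by rw [hg, P.star_form]
      simp only [map_sub, LinearMap.sub_apply, LinearMap.map_smulₛₗ, LinearMap.smul_apply,
        P.form_ract, P.ract_form, hyx, ← hg, Complex.conj_ofReal, map_smul, smul_sub]
      abel
    have h3 : star g * P.form x x * g ≤ (c : ℂ) • (star g * g) := by
      have := CStarAlgebra.star_left_conjugate_le_norm_smul (a := g) (b := P.form x x)
        (hb := IsSelfAdjoint.of_nonneg (P.form_self_nonneg x))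
      refine this.trans ?_
      rw [Complex.coe_smul]
      exact smul_le_smul_of_nonneg_right hc (star_mul_self_nonneg g)
    have h4 : (c : ℂ) • (star g * g) ≤ (c : ℂ) • ((c : ℂ) • P.form y y) := by
      rw [h2] at h1
      have := add_le_add h1 (sub_nonneg.2 h3)
      rw [← sub_nonneg]
      refine le_trans (le_of_eq (by simp)) (this.trans (le_of_eq ?_))
      abel
    rw [Complex.coe_smul, Complex.coe_smul, Complex.coe_smul,
      smul_le_smul_iff_of_pos_left hc0] at h4
    have h5 := CStarAlgebra.norm_le_norm_of_nonneg_of_le (star_mul_self_nonneg g) h4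
    rw [CStarRing.norm_star_mul_self, norm_smul, Real.norm_of_nonneg hc0.le] at h5
    rw [pow_two]
    exact h5
  refine le_of_forall_pos_le_add fun ε hε => ?_
  have h := key (‖P.form x x‖ + ε / (‖P.form y y‖ + 1)) (by linarith [show 0 < ε / (‖P.form y y‖ + 1) by positivity]) (by positivity)
  refine h.trans ?_
  rw [add_mul]
  gcongr
  rw [div_mul_eq_mul_div, div_le_iff₀ (by positivity)]
  nlinarith [norm_nonneg (P.form y y)]

lemma seminormCore :
    let _ : Norm P := ⟨fun x => √‖P.form x x‖⟩
    SeminormedSpace.Core ℂ P := by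
  let _ : Norm P := ⟨fun x => √‖P.form x x‖⟩
  have hn : ∀ x : P, ‖x‖ = √‖P.form x x‖ := fun _ => rfl
  have hs : ∀ x : P, ‖x‖ ^ 2 = ‖P.form x x‖ := fun x => by rw [hn, Real.sq_sqrt (norm_nonneg _)]
  refine ⟨fun x => Real.sqrt_nonneg _, fun c x => ?_, fun x y => ?_⟩
  · rw [hn, hn]
    simp only [LinearMap.map_smulₛₗ, LinearMap.smul_apply, map_smul, norm_smul, ← mul_assoc]
    rw [Real.sqrt_mul (by positivity)]
    simp
  · have h0 : 0 ≤ ‖x‖ := Real.sqrt_nonneg _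
    have h0' : 0 ≤ ‖y‖ := Real.sqrt_nonneg _
    have hxy : ‖P.form x y‖ ≤ ‖x‖ * ‖y‖ := by
      refine le_of_sq_le_sq ?_ (by positivity)
      rw [mul_pow, hs, hs]
      exact P.norm_form_sq_le x y
    refine le_of_sq_le_sq ?_ (by positivity)
    have hyx : ‖P.form y x‖ = ‖P.form x y‖ := by rw [← P.star_form, norm_star]
    calc ‖x + y‖ ^ 2 = ‖P.form x x + P.form y x + (P.form x y + P.form y y)‖ := by
            rw [hs]; simp only [map_add, LinearMap.add_apply]
      _ ≤ ‖P.form x x‖ + ‖P.form y x‖ + (‖P.form x y‖ + ‖P.form y y‖) :=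
            (norm_add_le _ _).trans (add_le_add (norm_add_le _ _) (norm_add_le _ _))
      _ ≤ (‖x‖ + ‖y‖) ^ 2 := by rw [hyx, ← hs, ← hs]; nlinarith

/-- The seminorm `‖x‖ = ‖⟨x | x⟩‖^{1/2}`. -/
instance : SeminormedAddCommGroup P :=
  letI : Norm P := ⟨fun x => √‖P.form x x‖⟩
  SeminormedAddCommGroup.ofCore (𝕜 := ℂ) P.seminormCore

lemma norm_sq (x : P) : ‖x‖ ^ 2 = ‖P.form x x‖ :=
  Real.sq_sqrt (norm_nonneg _)

instance : NormedSpace ℂ P where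
  norm_smul_le c x := (P.seminormCore.norm_smul c x).le

lemma norm_form_le (x y : P) : ‖P.form x y‖ ≤ ‖x‖ * ‖y‖ := by
  refine le_of_sq_le_sq ?_ (by positivity)
  rw [mul_pow, norm_sq, norm_sq]
  exact P.norm_form_sq_le x y

lemma continuous_form : Continuous fun p : P × P => P.form p.1 p.2 := by
  have : (fun p : P × P => P.form p.1 p.2) = fun p : P × P =>
      (LinearMap.mkContinuous₂ P.form 1 (fun x y => by simpa using P.norm_form_le x y)) p.1 p.2 := rfl
  rw [this]
  fun_prop

/-- The inner product on the completion, by continuity. -/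
def ipFun (x y : Completion P) : A :=
  (Completion.isDenseInducing_coe.prodMap Completion.isDenseInducing_coe).extend
    (fun p : P × P => P.form p.1 p.2) (x, y)

lemma ipFun_coe (x y : P) : P.ipFun x y = P.form x y :=
  (Completion.isDenseInducing_coe.prodMap Completion.isDenseInducing_coe).extend_eq
    P.continuous_form (x, y)

lemma continuous_ipFun : Continuous fun p : Completion P × Completion P => P.ipFun p.1 p.2 := by
  let φ : P →+ P →+ A :=
    { toFun := fun x => (P.form x).toAddMonoidHom
      map_zero' := by ext x; simp
      map_add' := fun x y => by ext z; simp }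
  have : Continuous fun p : P × P => φ p.1 p.2 := P.continuous_form
  exact (Completion.isDenseInducing_toCompl P).extend_Z_bilin
    (Completion.isDenseInducing_toCompl P) this

lemma continuous_ipFun' {X : Type*} [TopologicalSpace X] {f g : X → Completion P}
    (hf : Continuous f) (hg : Continuous g) : Continuous fun x => P.ipFun (f x) (g x) :=
  P.continuous_ipFun.comp (hf.prodMk hg)

/-- The extension to the completion of an operator that is bounded for the seminorm. -/
def extendOp {P Q : PreHilbertModule A} (S : P →ₗ[ℂ] Q) (hS : ∃ C : ℝ, ∀ x, ‖S x‖ ≤ C * ‖x‖) :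
    Completion P →L[ℂ] Completion Q :=
  ((Completion.toComplL (𝕜 := ℂ) (E := Q)).comp
    (S.mkContinuousOfExistsBound hS)).extend (Completion.toComplL (𝕜 := ℂ) (E := P))

lemma extendOp_coe {P Q : PreHilbertModule A} (S : P →ₗ[ℂ] Q)
    (hS : ∃ C : ℝ, ∀ x, ‖S x‖ ≤ C * ‖x‖) (x : P) :
    extendOp S hS (x : Completion P) = ((S x : Q) : Completion Q) :=
  ContinuousLinearMap.extend_eq _ Completion.denseRange_coe
    (Completion.isUniformInducing_coe P) x

lemma ract_bound (a : A) : ∃ C : ℝ, ∀ x, ‖P.ract a x‖ ≤ C * ‖x‖ := by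
  refine ⟨‖a‖, fun x => le_of_sq_le_sq ?_ (by positivity)⟩
  rw [norm_sq, P.form_ract, P.ract_form, mul_pow, norm_sq]
  calc ‖star a * P.form x x * a‖ ≤ ‖star a‖ * ‖P.form x x‖ * ‖a‖ :=
        (norm_mul_le _ _).trans (by gcongr; exact norm_mul_le _ _)
    _ = _ := by rw [norm_star]; ring

lemma ipFun_add_left (x y z : Completion P) :
    P.ipFun (x + y) z = P.ipFun x z + P.ipFun y z :=
  Completion.induction_on₃ x y z
    (isClosed_eq (P.continuous_ipFun' (by fun_prop) (by fun_prop))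
      ((P.continuous_ipFun' (by fun_prop) (by fun_prop)).add
        (P.continuous_ipFun' (by fun_prop) (by fun_prop))))
    fun x y z => by rw [← Completion.coe_add]; simp only [ipFun_coe, map_add, LinearMap.add_apply]

lemma ipFun_add_right (x y z : Completion P) :
    P.ipFun x (y + z) = P.ipFun x y + P.ipFun x z :=
  Completion.induction_on₃ x y z
    (isClosed_eq (P.continuous_ipFun' (by fun_prop) (by fun_prop))
      ((P.continuous_ipFun' (by fun_prop) (by fun_prop)).add
        (P.continuous_ipFun' (by fun_prop) (by fun_prop))))
    fun x y z => by rw [← Completion.coe_add]; simp only [ipFun_coe, map_add]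

lemma ipFun_smul_left (c : ℂ) (x y : Completion P) :
    P.ipFun (c • x) y = star c • P.ipFun x y :=
  Completion.induction_on₂ x y
    (isClosed_eq (P.continuous_ipFun' (continuous_fst.const_smul c) continuous_snd)
      ((P.continuous_ipFun' continuous_fst continuous_snd).const_smul _))
    fun x y => by
      rw [← Completion.coe_smul]
      simp only [ipFun_coe, LinearMap.map_smulₛₗ, LinearMap.smul_apply, starRingEnd_apply]

lemma ipFun_smul_right (c : ℂ) (x y : Completion P) :
    P.ipFun x (c • y) = c • P.ipFun x y :=
  Completion.induction_on₂ x y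
    (isClosed_eq (P.continuous_ipFun' continuous_fst (continuous_snd.const_smul c))
      ((P.continuous_ipFun' continuous_fst continuous_snd).const_smul _))
    fun x y => by
      rw [← Completion.coe_smul]
      simp only [ipFun_coe, map_smul]

/-- Separation and completion of a semi-inner-product module. -/
def toHilbertModule : HilbertModule A where
  carrier := Completion P
  ip := LinearMap.mk₂'ₛₗ (starRingEnd ℂ) (RingHom.id ℂ) P.ipFun P.ipFun_add_left
    P.ipFun_smul_left P.ipFun_add_right P.ipFun_smul_right
  star_ip x y := Completion.induction_on₂ x y
    (isClosed_eq (continuous_star.comp (P.continuous_ipFun' continuous_fst continuous_snd))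
      (P.continuous_ipFun' continuous_snd continuous_fst))
    fun x y => by simp only [LinearMap.mk₂'ₛₗ_apply, ipFun_coe, P.star_form]
  ip_self_nonneg x := Completion.induction_on x
    (isClosed_le continuous_const (P.continuous_ipFun' continuous_id continuous_id))
    fun x => by simp only [LinearMap.mk₂'ₛₗ_apply, ipFun_coe, P.form_self_nonneg]
  norm_sq x := Completion.induction_on x
    (isClosed_eq (by fun_prop) (P.continuous_ipFun' continuous_id continuous_id).norm)
    fun x => by simp only [LinearMap.mk₂'ₛₗ_apply, ipFun_coe, Completion.norm_coe, norm_sq]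
  ract a := extendOp (P.ract a) (P.ract_bound a)
  ip_ract x y a := Completion.induction_on₂ x y
    (isClosed_eq (P.continuous_ipFun' continuous_fst
        ((extendOp (P.ract a) (P.ract_bound a)).continuous.comp continuous_snd))
      ((P.continuous_ipFun' continuous_fst continuous_snd).mul continuous_const))
    fun x y => by
      simp only [LinearMap.mk₂'ₛₗ_apply, ContinuousLinearMap.coe_coe, extendOp_coe, ipFun_coe,
        P.form_ract]

/-- The canonical map into the completion. -/
def cls : P →ₗ[ℂ] P.toHilbertModule := (Completion.toComplL (𝕜 := ℂ) (E := P)).toLinearMap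

lemma ip_cls (x y : P) : P.toHilbertModule.ip (P.cls x) (P.cls y) = P.form x y := P.ipFun_coe x y

lemma ract_cls (a : A) (x : P) : P.toHilbertModule.ract a (P.cls x) = P.cls (P.ract a x) :=
  extendOp_coe _ _ x

lemma denseRange_cls : DenseRange P.cls := Completion.denseRange_coe

end PreHilbertModule

namespace HilbertModule

variable (E : HilbertModule A)

lemma ract_ip (x y : E) (a : A) : E.ip (E.ract a x) y = star a * E.ip x y := by
  rw [← E.star_ip, E.ip_ract, star_mul, E.star_ip]

lemma norm_ip_le (x y : E) : ‖E.ip x y‖ ≤ ‖x‖ * ‖y‖ := by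
  let P : PreHilbertModule A :=
    { carrier := E, form := E.ip, star_form := E.star_ip, form_self_nonneg := E.ip_self_nonneg,
      ract := E.ract, form_ract := E.ip_ract }
  refine le_of_sq_le_sq ?_ (by positivity)
  rw [mul_pow, E.norm_sq, E.norm_sq]
  exact P.norm_form_sq_le x y

lemma continuous_ip : Continuous fun p : E × E => E.ip p.1 p.2 := by
  have : (fun p : E × E => E.ip p.1 p.2) = fun p : E × E =>
      (LinearMap.mkContinuous₂ E.ip 1 (fun x y => by simpa using E.norm_ip_le x y)) p.1 p.2 := rfl
  rw [this]
  fun_prop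

lemma continuous_ip' {X : Type*} [TopologicalSpace X] {f g : X → E}
    (hf : Continuous f) (hg : Continuous g) : Continuous fun x => E.ip (f x) (g x) :=
  E.continuous_ip.comp (hf.prodMk hg)

lemma ext_ip {x y : E} (h : ∀ z, E.ip z x = E.ip z y) : x = y := by
  rw [← sub_eq_zero, ← norm_eq_zero, ← sq_eq_zero_iff, E.norm_sq, map_sub, h, sub_self, norm_zero]

lemma ract_mul (x : E) (a b : A) : E.ract (a * b) x = E.ract b (E.ract a x) :=
  E.ext_ip fun z => by simp only [E.ip_ract, mul_assoc]

lemma ract_one (x : E) : E.ract 1 x = x :=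
  E.ext_ip fun z => by simp only [E.ip_ract, mul_one]

lemma ract_add (x : E) (a b : A) : E.ract (a + b) x = E.ract a x + E.ract b x :=
  E.ext_ip fun z => by simp only [E.ip_ract, map_add, mul_add]

lemma ract_smul (x : E) (c : ℂ) (a : A) : E.ract (c • a) x = c • E.ract a x :=
  E.ext_ip fun z => by simp only [E.ip_ract, map_smul, mul_smul_comm]

lemma norm_ract_le (x : E) (a : A) : ‖E.ract a x‖ ≤ ‖a‖ * ‖x‖ := by
  refine le_of_sq_le_sq ?_ (by positivity)
  rw [E.norm_sq, E.ip_ract, E.ract_ip, mul_pow, E.norm_sq]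
  calc ‖star a * E.ip x x * a‖ ≤ ‖star a‖ * ‖E.ip x x‖ * ‖a‖ :=
        (norm_mul_le _ _).trans (by gcongr; exact norm_mul_le _ _)
    _ = _ := by rw [norm_star]; ring

lemma continuous_ract (a : A) : Continuous (E.ract a) :=
  ((E.ract a).mkContinuous ‖a‖ fun x => E.norm_ract_le x a).continuous

/-! ### The C*-algebra of adjointable operators -/

/-- The algebra of adjointable operators. -/
def adjointable : Subalgebra ℂ (E →L[ℂ] E) where
  carrier := {S | ∃ S' : E →L[ℂ] E, ∀ x y, E.ip (S x) y = E.ip x (S' y)}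
  mul_mem' := by
    rintro S T ⟨S', hS⟩ ⟨T', hT⟩
    exact ⟨T' * S', fun x y => by simp [hS, hT]⟩
  add_mem' := by
    rintro S T ⟨S', hS⟩ ⟨T', hT⟩
    exact ⟨S' + T', fun x y => by simp [hS, hT]⟩
  algebraMap_mem' c := ⟨algebraMap ℂ _ (star c), fun x y => by
    simp [Algebra.algebraMap_eq_smul_one]⟩

end HilbertModule

/-- `End†(E_A)`, the C*-algebra of adjointable operators on `E`, with the operator norm. -/
def Adj (E : HilbertModule A) : Type u := E.adjointable

namespace Adj

variable {E : HilbertModule A}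

instance : NormedRing (Adj E) := inferInstanceAs (NormedRing E.adjointable)
instance : NormedAlgebra ℂ (Adj E) := inferInstanceAs (NormedAlgebra ℂ E.adjointable)

/-- The underlying bounded operator. -/
def toCLM : Adj E →ₐ[ℂ] (E →L[ℂ] E) := E.adjointable.val

instance : CoeFun (Adj E) (fun _ => E → E) := ⟨fun S => toCLM S⟩

@[ext] lemma ext {S T : Adj E} (h : ∀ x, S x = T x) : S = T :=
  Subtype.ext (ContinuousLinearMap.ext h)

lemma norm_def (S : Adj E) : ‖S‖ = ‖toCLM S‖ := rfl

/-- An operator with a formal adjoint, as an element of `Adj E`. -/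
def mk (S S' : E →L[ℂ] E) (h : ∀ x y, E.ip (S x) y = E.ip x (S' y)) : Adj E := ⟨S, S', h⟩

@[simp] lemma mk_apply (S S' : E →L[ℂ] E) (h) (x : E) : mk S S' h x = S x := rfl

instance : Star (Adj E) where
  star S := mk S.2.choose (toCLM S) fun x y => by
    rw [← E.star_ip, ← S.2.choose_spec, E.star_ip]; rfl

/-- The adjoint is characterized by `⟨S x | y⟩ = ⟨x | S* y⟩`. -/
lemma ip_star (S : Adj E) (x y : E) : E.ip x ((star S) y) = E.ip (S x) y :=
  (S.2.choose_spec x y).symm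

lemma star_ip (S : Adj E) (x y : E) : E.ip ((star S) x) y = E.ip x (S y) := by
  rw [← E.star_ip, ip_star, E.star_ip]

@[simp] lemma add_apply (S T : Adj E) (x : E) : (S + T) x = S x + T x := rfl
@[simp] lemma mul_apply (S T : Adj E) (x : E) : (S * T) x = S (T x) := rfl
@[simp] lemma smul_apply (c : ℂ) (S : Adj E) (x : E) : (c • S) x = c • S x := rfl
@[simp] lemma one_apply (x : E) : (1 : Adj E) x = x := rfl

lemma star_eq_of {S T : Adj E} (h : ∀ x y, E.ip (S x) y = E.ip x (T y)) : star S = T :=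
  ext fun y => E.ext_ip fun x => by rw [ip_star, h]

instance : StarRing (Adj E) where
  star_involutive S := star_eq_of fun x y => by rw [star_ip]
  star_mul S T := star_eq_of fun x y => by simp only [mul_apply, ip_star]
  star_add S T := star_eq_of fun x y => by
    rw [add_apply, add_apply, map_add, map_add, LinearMap.add_apply, ip_star, ip_star]

instance : StarModule ℂ (Adj E) where
  star_smul c S := star_eq_of fun x y => by
    rw [smul_apply, smul_apply, LinearMap.map_smulₛₗ E.ip, LinearMap.smul_apply,
      map_smul (E.ip x), ip_star, starRingEnd_apply]

instance : CStarRing (Adj E) where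
  norm_mul_self_le S := by
    rw [← pow_two]
    refine (Real.le_sqrt (norm_nonneg _) (norm_nonneg _)).1 ?_
    rw [norm_def S]
    refine ContinuousLinearMap.opNorm_le_bound _ (Real.sqrt_nonneg _) fun x => ?_
    refine le_of_sq_le_sq ?_ (by positivity)
    rw [mul_pow, Real.sq_sqrt (norm_nonneg _), E.norm_sq, ← ip_star, ← mul_apply]
    calc _ ≤ ‖x‖ * ‖(star S * S) x‖ := E.norm_ip_le _ _
      _ ≤ ‖x‖ * (‖star S * S‖ * ‖x‖) := by gcongr; exact (toCLM (star S * S)).le_opNorm x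
      _ = _ := by ring

lemma isClosed_adjointable : IsClosed (E.adjointable : Set (E →L[ℂ] E)) := by
  rw [← isSeqClosed_iff_isClosed]
  intro S S₀ hS hlim
  let T : ℕ → Adj E := fun n => ⟨S n, hS n⟩
  have hT : ∀ n, toCLM (T n) = S n := fun _ => rfl
  have hc : CauchySeq fun n => toCLM (star (T n)) := by
    have := hlim.cauchySeq
    rw [Metric.cauchySeq_iff] at this ⊢
    intro ε hε
    obtain ⟨N, hN⟩ := this ε hε
    refine ⟨N, fun m hm n hn => ?_⟩
    have h := hN m hm n hn
    rw [dist_eq_norm] at h ⊢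
    rw [← map_sub, ← norm_def, ← star_sub, norm_star, norm_def, map_sub]
    exact h
  obtain ⟨S', hS'⟩ := cauchySeq_tendsto_of_complete hc
  refine ⟨S', fun x y => ?_⟩
  have h1 : Filter.Tendsto (fun n => E.ip (S n x) y) Filter.atTop (nhds (E.ip (S₀ x) y)) :=
    ((E.continuous_ip' continuous_id continuous_const).tendsto _).comp
      (((ContinuousLinearMap.apply ℂ E x).continuous.tendsto _).comp hlim)
  have h2 : Filter.Tendsto (fun n => E.ip x (toCLM (star (T n)) y)) Filter.atTop
      (nhds (E.ip x (S' y))) :=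
    ((E.continuous_ip' continuous_const continuous_id).tendsto _).comp
      (((ContinuousLinearMap.apply ℂ E y).continuous.tendsto _).comp hS')
  refine tendsto_nhds_unique h1 (h2.congr fun n => ?_)
  rw [ip_star, hT]

instance : CompleteSpace (Adj E) := isClosed_adjointable.completeSpace_coe

instance : CStarAlgebra (Adj E) where

/-- The canonical order of a C*-algebra: positive elements are those of the form `star S * S`. -/
instance : PartialOrder (Adj E) := CStarAlgebra.spectralOrder _
instance : StarOrderedRing (Adj E) := CStarAlgebra.spectralOrderedRing _

/-- Adjointable operators are `A`-linear. -/
lemma apply_ract (S : Adj E) (a : A) (x : E) : S (E.ract a x) = E.ract a (S x) :=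
  E.ext_ip fun z => by rw [← star_ip, E.ip_ract, E.ip_ract, star_ip]

lemma continuous_apply (S : Adj E) : Continuous S := (toCLM S).continuous

end Adj

/-! ### Positive kernels -/

lemma exists_negPart {D : Type*} [CStarAlgebra D] [PartialOrder D] [StarOrderedRing D]
    (M : D) (hsa : IsSelfAdjoint M) :
    ∃ N R : D, N = star R * R ∧ star N * M * N = -(star (R * N) * (R * N)) ∧ (N = 0 → 0 ≤ M) := by
  have hN0 : 0 ≤ M⁻ := CFC.negPart_nonneg M
  have hNs : star M⁻ = M⁻ := (IsSelfAdjoint.of_nonneg hN0).star_eq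
  obtain ⟨R, hR⟩ := CStarAlgebra.nonneg_iff_eq_star_mul_self.1 hN0
  refine ⟨M⁻, R, hR, ?_, fun h => (CFC.negPart_eq_zero_iff M hsa).1 h⟩
  have h2 : M * M⁻ = -(M⁻ * M⁻) := by
    conv_lhs => enter [1]; rw [← CFC.posPart_sub_negPart M hsa]
    rw [sub_mul, CFC.posPart_mul_negPart, zero_sub]
  rw [mul_assoc, h2, star_mul, mul_neg, hNs, mul_assoc, ← mul_assoc (star R), ← hR]

/-- A matrix `M` over a C*-algebra is positive as soon as `∑ bᵢ* Mᵢⱼ bⱼ ≥ 0` for all `b`. -/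
lemma matrix_nonneg_of_sandwich {n : ℕ} (M : CStarMatrix (Fin n) (Fin n) A)
    (hs : ∀ i j, star (M i j) = M j i)
    (h : ∀ b : Fin n → A, 0 ≤ ∑ i, ∑ j, star (b i) * M i j * b j) : 0 ≤ M := by
  have hsa : IsSelfAdjoint M := by
    ext i j
    rw [CStarMatrix.star_apply, hs]
  obtain ⟨N, R, hR, h1, h0⟩ := exists_negPart M hsa
  refine h0 ?_
  have hNs : star N = N := by rw [hR, star_mul, star_star]
  have hz : R * N = 0 := by
    ext k l
    have h3 : 0 ≤ (star N * M * N) l l := by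
      have := h fun i => N i l
      refine this.trans (le_of_eq ?_)
      simp only [CStarMatrix.mul_apply, CStarMatrix.star_apply, Finset.sum_mul]
      exact Finset.sum_comm
    rw [h1, CStarMatrix.neg_apply, CStarMatrix.mul_apply] at h3
    simp only [CStarMatrix.star_apply] at h3
    have h4 : ∑ r, star ((R * N) r l) * (R * N) r l = 0 :=
      le_antisymm (neg_nonneg.1 h3) (Finset.sum_nonneg fun r _ => star_mul_self_nonneg _)
    have h5 := (Finset.sum_eq_zero_iff_of_nonneg (fun r _ => star_mul_self_nonneg _)).1 h4 k
      (Finset.mem_univ _)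
    simpa using (CStarRing.star_mul_self_eq_zero_iff _).1 h5
  have h6 : N * N = 0 := by
    conv_lhs => enter [1]; rw [hR]
    rw [mul_assoc, hz, mul_zero]
  refine (CStarRing.star_mul_self_eq_zero_iff N).1 ?_
  rw [hNs, h6]

/-- Gram matrices are positive. -/
lemma HilbertModule.gram_nonneg (E : HilbertModule A) {n : ℕ} (e : Fin n → E) :
    0 ≤ CStarMatrix.ofMatrix (fun i j => E.ip (e i) (e j)) := by
  refine matrix_nonneg_of_sandwich _ (fun i j => E.star_ip _ _) fun b => ?_
  have := E.ip_self_nonneg (∑ i, E.ract (b i) (e i))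
  refine this.trans (le_of_eq ?_)
  simp only [map_sum, LinearMap.sum_apply, E.ip_ract, E.ract_ip]
  exact Finset.sum_comm

/-! ### Correspondences -/

/-- A right C*-correspondence from `B` to `A`: a Hilbert `A`-module with a unital left action of
`B` by adjointable operators, `lact b x = b ▷ x`. -/
structure Correspondence (B A : Type u) [CStarAlgebra B] [CStarAlgebra A] [PartialOrder A]
    [StarOrderedRing A] extends HilbertModule A where
  lact : B →⋆ₐ[ℂ] Adj toHilbertModule

/-- A semi-inner-product module with a left action by formally adjointable operators. -/
structure PreCorrespondence (B A : Type u) [CStarAlgebra B] [CStarAlgebra A] [PartialOrder A]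
    [StarOrderedRing A] extends PreHilbertModule A where
  lact : B →ₐ[ℂ] Module.End ℂ toPreHilbertModule
  form_lact : ∀ b x y, form (lact b x) y = form x (lact (star b) y)

variable {B : Type u} [CStarAlgebra B]

instance : CoeSort (Correspondence B A) (Type u) := ⟨fun X => X.carrier⟩
instance : CoeSort (PreCorrespondence B A) (Type u) := ⟨fun X => X.carrier⟩

/-- `‖b‖² - b* b` has the form `c* c`. -/
lemma exists_norm_sq_sub (b : B) :
    ∃ c : B, star c * c = ((‖b‖ ^ 2 : ℝ) : ℂ) • (1 : B) - star b * b := by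
  let _ : PartialOrder B := CStarAlgebra.spectralOrder B
  have _ : StarOrderedRing B := CStarAlgebra.spectralOrderedRing B
  have h : 0 ≤ ((‖b‖ ^ 2 : ℝ) : ℂ) • (1 : B) - star b * b := by
    rw [sub_nonneg]
    have := IsSelfAdjoint.le_algebraMap_norm_self (a := star b * b) (.star_mul_self b)
    rwa [CStarRing.norm_star_mul_self, ← pow_two, Algebra.algebraMap_eq_smul_one,
      ← Complex.coe_smul] at this
  obtain ⟨c, hc⟩ := CStarAlgebra.nonneg_iff_eq_star_mul_self.1 h
  exact ⟨c, hc.symm⟩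

namespace PreCorrespondence

variable (P : PreCorrespondence B A)

/-- A formally adjointable left action of a C*-algebra is automatically bounded. -/
lemma form_lact_le (b : B) (x : P) :
    P.form (P.lact b x) (P.lact b x) ≤ ((‖b‖ ^ 2 : ℝ) : ℂ) • P.form x x := by
  obtain ⟨c, hc⟩ := exists_norm_sq_sub b
  have h := P.form_self_nonneg (P.lact c x)
  rw [P.form_lact, ← Module.End.mul_apply, ← map_mul, hc, map_sub, map_smul, map_one,
    LinearMap.sub_apply, map_sub, LinearMap.smul_apply, map_smul, Module.End.one_apply,
    map_mul, Module.End.mul_apply, ← P.form_lact, sub_nonneg] at h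
  exact h

lemma norm_lact_le (b : B) (x : P) : ‖P.lact b x‖ ≤ ‖b‖ * ‖x‖ := by
  refine le_of_sq_le_sq ?_ (by positivity)
  rw [P.norm_sq, mul_pow, P.norm_sq]
  refine (CStarAlgebra.norm_le_norm_of_nonneg_of_le (P.form_self_nonneg _)
    (P.form_lact_le b x)).trans ?_
  rw [norm_smul, Complex.norm_real, Real.norm_of_nonneg (by positivity)]

lemma lact_bound (b : B) : ∃ C : ℝ, ∀ x : P, ‖P.lact b x‖ ≤ C * ‖x‖ := ⟨‖b‖, P.norm_lact_le b⟩

end PreCorrespondence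

/-- Two formally adjoint bounded operators between semi-inner-product modules stay adjoint on the
completions. -/
lemma PreHilbertModule.ip_extendOp {P Q : PreHilbertModule A} (S : P →ₗ[ℂ] Q) (S' : Q →ₗ[ℂ] P) (hS hS')
    (h : ∀ x y, Q.form (S x) y = P.form x (S' y))
    (x : P.toHilbertModule) (y : Q.toHilbertModule) :
    Q.toHilbertModule.ip (extendOp S hS x) y = P.toHilbertModule.ip x (extendOp S' hS' y) :=
  Completion.induction_on₂ x y
    (isClosed_eq (Q.continuous_ipFun' ((extendOp S hS).continuous.comp continuous_fst)
        continuous_snd)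
      (P.continuous_ipFun' continuous_fst ((extendOp S' hS').continuous.comp continuous_snd)))
    fun x y => by
      have h1 : Q.ipFun (extendOp S hS (x : Completion P)) (y : Completion Q)
        = P.ipFun (x : Completion P) (extendOp S' hS' (y : Completion Q)) := by
        rw [extendOp_coe, extendOp_coe, ipFun_coe, ipFun_coe, h]
      exact h1

/-- The formal adjoint of a bounded operator is bounded. -/
lemma PreHilbertModule.bound_of_adjoint {P Q : PreHilbertModule A} (S : P →ₗ[ℂ] Q)
    (S' : Q →ₗ[ℂ] P) (hS : ∃ C : ℝ, ∀ x, ‖S x‖ ≤ C * ‖x‖)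
    (h : ∀ x y, Q.form (S x) y = P.form x (S' y)) : ∃ C : ℝ, ∀ x, ‖S' x‖ ≤ C * ‖x‖ := by
  obtain ⟨C₀, hC₀⟩ := hS
  set C := max C₀ 0
  have hC0 : 0 ≤ C := le_max_right _ _
  have hC : ∀ x, ‖S x‖ ≤ C * ‖x‖ := fun x =>
    (hC₀ x).trans (mul_le_mul_of_nonneg_right (le_max_left _ _) (norm_nonneg x))
  refine ⟨C, fun y => ?_⟩
  have h1 : ‖S' y‖ ^ 2 ≤ C * ‖y‖ * ‖S' y‖ := by
    rw [P.norm_sq, ← h]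
    refine (Q.norm_form_le _ _).trans ?_
    nlinarith [hC (S' y), norm_nonneg y]
  rcases (norm_nonneg (S' y)).eq_or_lt with h0 | h0
  · rw [← h0]; positivity
  · nlinarith

/-- An element of `End†` of the completion, from a bounded operator with a formal adjoint. -/
def PreHilbertModule.extendAdj (P : PreHilbertModule A) (S S' : P →ₗ[ℂ] P)
    (hS : ∃ C : ℝ, ∀ x, ‖S x‖ ≤ C * ‖x‖) (h : ∀ x y, P.form (S x) y = P.form x (S' y)) :
    Adj P.toHilbertModule :=
  Adj.mk (extendOp S hS) (extendOp S' (bound_of_adjoint S S' hS h))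
    (ip_extendOp S S' hS _ h)

lemma PreHilbertModule.extendAdj_cls (P : PreHilbertModule A) (S S' : P →ₗ[ℂ] P) (hS h) (x : P) :
    P.extendAdj S S' hS h (P.cls x) = P.cls (S x) := extendOp_coe S hS x

lemma PreHilbertModule.adj_ext (P : PreHilbertModule A) {S T : Adj P.toHilbertModule}
    (h : ∀ x, S (P.cls x) = T (P.cls x)) : S = T :=
  Adj.ext fun x => congrFun (P.denseRange_cls.equalizer S.continuous_apply T.continuous_apply
    (funext h)) x

/-- Separation and completion. -/
def PreCorrespondence.toCorrespondence (P : PreCorrespondence B A) : Correspondence B A where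
  toHilbertModule := P.toPreHilbertModule.toHilbertModule
  lact :=
    { toFun := fun b => P.extendAdj (P.lact b) (P.lact (star b)) (P.lact_bound b) (P.form_lact b)
      map_one' := P.adj_ext fun x => by
        rw [P.extendAdj_cls, map_one]; rfl
      map_mul' := fun a b => P.adj_ext fun x => by
        rw [Adj.mul_apply, P.extendAdj_cls, P.extendAdj_cls, P.extendAdj_cls, map_mul]; rfl
      map_zero' := P.adj_ext fun x => by
        rw [P.extendAdj_cls, map_zero]; exact map_zero _
      map_add' := fun a b => P.adj_ext fun x => by
        rw [Adj.add_apply, P.extendAdj_cls, P.extendAdj_cls, P.extendAdj_cls, map_add]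
        exact map_add _ _ _
      commutes' := fun c => P.adj_ext fun x => by
        rw [P.extendAdj_cls, Algebra.algebraMap_eq_smul_one, Algebra.algebraMap_eq_smul_one,
          Adj.smul_apply, map_smul, map_one, LinearMap.smul_apply, map_smul]; rfl
      map_star' := fun b => by
        refine (Adj.star_eq_of fun x y => ?_).symm
        exact PreHilbertModule.ip_extendOp _ _ _ _ (P.form_lact b) x y }

/-- The class of an element in the separated completion. -/
def PreCorrespondence.cls (P : PreCorrespondence B A) : P →ₗ[ℂ] P.toCorrespondence :=
  P.toPreHilbertModule.cls

lemma PreCorrespondence.lact_cls (P : PreCorrespondence B A) (b : B) (x : P) :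
    P.toCorrespondence.lact b (P.cls x) = P.cls (P.lact b x) :=
  PreHilbertModule.extendOp_coe (P.lact b) (P.lact_bound b) x

/-! ### Basic constructions of correspondences -/

/-- `A` as a Hilbert module over itself, `⟨x | y⟩ = x* y`. -/
def HilbertModule.self (A : Type u) [CStarAlgebra A] [PartialOrder A] [StarOrderedRing A] :
    HilbertModule A where
  carrier := A
  ip := LinearMap.mk₂'ₛₗ (starRingEnd ℂ) (RingHom.id ℂ) (fun x y => star x * y)
    (fun x y z => by rw [star_add, add_mul])
    (fun c x y => by rw [star_smul, smul_mul_assoc, starRingEnd_apply])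
    (fun x y z => mul_add _ _ _)
    (fun c x y => mul_smul_comm _ _ _)
  star_ip x y := by simp
  ip_self_nonneg x := star_mul_self_nonneg x
  norm_sq x := by simp [CStarRing.norm_star_mul_self, pow_two]
  ract a := LinearMap.mulRight ℂ a
  ip_ract x y a := by simp [mul_assoc]

lemma star_mul_mul_aux {A : Type*} [CStarAlgebra A] (a x y : A) : star (a * x) * y = star x * (star a * y) := by
  rw [star_mul, mul_assoc]

/-- `A` as an `A`-`A` correspondence. -/
def Correspondence.self (A : Type u) [CStarAlgebra A] [PartialOrder A] [StarOrderedRing A] :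
    Correspondence A A where
  toHilbertModule := HilbertModule.self A
  lact :=
    { toFun := fun a => Adj.mk (E := HilbertModule.self A) (ContinuousLinearMap.mul ℂ A a)
        (ContinuousLinearMap.mul ℂ A (star a)) 
          (star_mul_mul_aux (A := A) a)
      map_one' := Adj.ext fun x => one_mul (M := A) x
      map_mul' := fun a b => Adj.ext fun x => mul_assoc (G := A) a b x
      map_zero' := Adj.ext fun x => zero_mul (M₀ := A) x
      map_add' := fun a b => Adj.ext fun x => add_mul (R := A) a b x
      commutes' := fun c => Adj.ext fun x => (Algebra.smul_def (A := A) c x).symm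
      map_star' := fun a => (Adj.star_eq_of (star_mul_mul_aux (A := A) a)).symm }

lemma exists_eq_star_mul_self {D : Type*} [CStarAlgebra D] [PartialOrder D] [StarOrderedRing D]
    {M : D} (h : 0 ≤ M) : ∃ R, M = star R * R :=
  CStarAlgebra.nonneg_iff_eq_star_mul_self.1 h

section Kernel

variable {D L : Type u} [CStarAlgebra D] [CStarAlgebra L]
  {V : Type u} [AddCommGroup V] [Module ℂ V] (q : V →ₗ⋆[ℂ] V →ₗ[ℂ] D) (Y : Correspondence D A)

/-- `v', y' ↦ ⟨y | q(v, v') ▷ y'⟩`. -/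
def kernelFormAux (v : V) (y : Y) : V →ₗ[ℂ] Y →ₗ[ℂ] A :=
  LinearMap.mk₂ ℂ (fun v' y' => Y.ip y (Y.lact (q v v') y'))
    (fun a b y' => by rw [map_add, map_add, Adj.add_apply, map_add])
    (fun c a y' => by rw [map_smul, map_smul, Adj.smul_apply, map_smul])
    (fun a y' z' => by rw [map_add, map_add])
    (fun c a y' => by rw [map_smul, map_smul])

/-- The form `⟨v ⊗ y | v' ⊗ y'⟩ = ⟨y | q(v, v') ▷ y'⟩` on the algebraic tensor product. -/
def kernelForm : (V ⊗[ℂ] Y) →ₗ⋆[ℂ] (V ⊗[ℂ] Y) →ₗ[ℂ] A :=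
  TensorProduct.lift <| LinearMap.mk₂'ₛₗ (starRingEnd ℂ) (starRingEnd ℂ)
    (fun v y => TensorProduct.lift (kernelFormAux q Y v y))
    (fun a b y => TensorProduct.ext' fun v' y' => by
      rw [LinearMap.add_apply]
      simp only [TensorProduct.lift.tmul, kernelFormAux, LinearMap.mk₂_apply]
      rw [map_add, LinearMap.add_apply, map_add, Adj.add_apply, map_add])
    (fun c a y => TensorProduct.ext' fun v' y' => by
      rw [LinearMap.smul_apply]
      simp only [TensorProduct.lift.tmul, kernelFormAux, LinearMap.mk₂_apply]
      rw [LinearMap.map_smulₛₗ q, LinearMap.smul_apply, map_smul, Adj.smul_apply, map_smul])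
    (fun a y z => TensorProduct.ext' fun v' y' => by
      simp only [TensorProduct.lift.tmul, kernelFormAux, LinearMap.mk₂_apply, LinearMap.add_apply,
        map_add])
    (fun c a y => TensorProduct.ext' fun v' y' => by
      rw [LinearMap.smul_apply]
      simp only [TensorProduct.lift.tmul, kernelFormAux, LinearMap.mk₂_apply, LinearMap.map_smulₛₗ,
        LinearMap.smul_apply])

@[simp] lemma kernelForm_tmul (v v' : V) (y y' : Y) :
    kernelForm q Y (v ⊗ₜ y) (v' ⊗ₜ y') = Y.ip y (Y.lact (q v v') y') := rfl

variable {q Y} in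
lemma star_kernelForm (hq : ∀ v w, star (q v w) = q w v) (x y : V ⊗[ℂ] Y) :
    star (kernelForm q Y x y) = kernelForm q Y y x := by
  induction x with
  | zero => simp
  | add x x' h h' => simp only [map_add, LinearMap.add_apply, star_add, h, h']
  | tmul v y₀ =>
    induction y with
    | zero => simp
    | add x x' h h' => simp only [map_add, LinearMap.add_apply, star_add, h, h']
    | tmul w z =>
      rw [kernelForm_tmul, kernelForm_tmul, Y.star_ip, ← Adj.ip_star, ← map_star, hq]

variable [PartialOrder D] [StarOrderedRing D]

variable {q Y} in
lemma kernelForm_self_nonneg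
    (hpos : ∀ (n : ℕ) (v : Fin n → V), 0 ≤ CStarMatrix.ofMatrix (fun i j => q (v i) (v j)))
    (x : V ⊗[ℂ] Y) : 0 ≤ kernelForm q Y x x := by
  obtain ⟨n, v, y, rfl⟩ : ∃ (n : ℕ) (v : Fin n → V) (y : Fin n → Y), x = ∑ i, v i ⊗ₜ y i := by
    obtain ⟨S, rfl⟩ := TensorProduct.exists_finset x
    refine ⟨S.card, fun i => (S.equivFin.symm i).1.1, fun i => (S.equivFin.symm i).1.2, ?_⟩
    rw [← Finset.sum_coe_sort]
    exact (S.equivFin.symm.sum_comp fun p : S => p.1.1 ⊗ₜ[ℂ] p.1.2).symm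
  obtain ⟨R, hR⟩ := exists_eq_star_mul_self (hpos n v)
  have hq : ∀ i j, q (v i) (v j) = ∑ r, star (R r i) * R r j := fun i j => by
    have := congrArg (fun M : CStarMatrix (Fin n) (Fin n) D => M i j) hR
    refine this.trans ?_
    simp [CStarMatrix.mul_apply, CStarMatrix.star_apply]
  have h : kernelForm q Y (∑ i, v i ⊗ₜ y i) (∑ i, v i ⊗ₜ y i) =
      ∑ r, Y.ip (∑ i, Y.lact (R r i) (y i)) (∑ j, Y.lact (R r j) (y j)) := by
    have h1 : ∀ i j, Y.ip (y i) (Y.lact (q (v i) (v j)) (y j)) =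
        ∑ r, Y.ip (Y.lact (R r i) (y i)) (Y.lact (R r j) (y j)) := fun i j => by
      have h2 : Y.lact (q (v i) (v j)) (y j) = ∑ r, Y.lact (star (R r i)) (Y.lact (R r j) (y j)) := by
        rw [hq, map_sum, map_sum, sum_apply]
        refine Finset.sum_congr rfl fun r _ => ?_
        rw [map_mul, Adj.mul_apply]
      rw [h2, map_sum]
      refine Finset.sum_congr rfl fun r _ => ?_
      rw [map_star, Adj.ip_star]
    simp only [map_sum, LinearMap.sum_apply, kernelForm_tmul, h1]
    rw [Finset.sum_comm_cycle]
  rw [h]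
  exact Finset.sum_nonneg fun r _ => Y.ip_self_nonneg _

/-- The correspondence obtained from `V ⊙ Y` with inner product
`⟨v ⊗ y | v' ⊗ y'⟩ = ⟨y | q(v, v') ▷ y'⟩` for a positive kernel `q`, before separation and
completion; `L` acts on the first leg, the right action is on the second leg. -/
def kernelTensor (hq : ∀ v w, star (q v w) = q w v)
    (hpos : ∀ (n : ℕ) (v : Fin n → V), 0 ≤ CStarMatrix.ofMatrix (fun i j => q (v i) (v j)))
    (l : L →ₐ[ℂ] Module.End ℂ V) (hl : ∀ b v w, q (l b v) w = q v (l (star b) w)) :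
    PreCorrespondence L A where
  carrier := V ⊗[ℂ] Y
  form := kernelForm q Y
  star_form := star_kernelForm hq
  form_self_nonneg := kernelForm_self_nonneg hpos
  ract a := (Y.ract a).lTensor V
  form_ract x y a := by
    induction x with
    | zero => simp
    | add x x' h h' => simp only [map_add, LinearMap.add_apply, add_mul, h, h']
    | tmul v y₀ =>
      induction y with
      | zero => simp
      | add x x' h h' => simp only [map_add, add_mul, h, h']
      | tmul w z =>
        rw [LinearMap.lTensor_tmul, kernelForm_tmul, kernelForm_tmul, Adj.apply_ract, Y.ip_ract]
  lact := (Module.End.rTensorAlgHom ℂ V Y).comp l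
  form_lact b x y := by
    change kernelForm q Y ((l b).rTensor Y x) y = kernelForm q Y x ((l (star b)).rTensor Y y)
    induction x with
    | zero => simp
    | add x x' h h' => simp only [map_add, LinearMap.add_apply, h, h']
    | tmul v y₀ =>
      induction y with
      | zero => simp
      | add x x' h h' => simp only [map_add, h, h']
      | tmul w z =>
        rw [LinearMap.rTensor_tmul, LinearMap.rTensor_tmul, kernelForm_tmul, kernelForm_tmul, hl]

end Kernel

section Tensor

variable {D L : Type u} [CStarAlgebra D] [PartialOrder D] [StarOrderedRing D] [CStarAlgebra L]

/-- The left action by plain linear maps. -/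
def Correspondence.lactEnd (X : Correspondence L D) : L →ₐ[ℂ] Module.End ℂ X where
  toFun b := (Adj.toCLM (X.lact b)).toLinearMap
  map_one' := by rw [map_one, map_one]; rfl
  map_mul' a b := by rw [map_mul, map_mul]; rfl
  map_zero' := by rw [map_zero, map_zero]; rfl
  map_add' a b := by rw [map_add, map_add]; rfl
  commutes' c := by rw [AlgHomClass.commutes, AlgHomClass.commutes]; rfl

/-- `X ⊙ Y` with `⟨x ⊗ y | x' ⊗ y'⟩_A = ⟨y | ⟨x | x'⟩_D ▷ y'⟩_A`. -/
def preInteriorTensor (X : Correspondence L D) (Y : Correspondence D A) : PreCorrespondence L A :=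
  kernelTensor X.ip Y X.star_ip (fun _ v => X.gram_nonneg v) X.lactEnd fun b v w => by
    change X.ip (X.lact b v) w = X.ip v (X.lact (star b) w)
    rw [map_star, Adj.ip_star]

/-- The (interior) tensor product `X ⊠_D Y` of correspondences. -/
def interiorTensor (X : Correspondence L D) (Y : Correspondence D A) : Correspondence L A :=
  (preInteriorTensor X Y).toCorrespondence

/-- The elementary tensor `x ⊠ y`. -/
def boxTmul (X : Correspondence L D) (Y : Correspondence D A) (x : X) (y : Y) :
    interiorTensor X Y :=
  (preInteriorTensor X Y).cls (x ⊗ₜ[ℂ] y : X.carrier ⊗[ℂ] Y.carrier)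

/-- `a, a' ↦ θ(a* a')`. -/
def cpKernel (θ : A →CP D) : A →ₗ⋆[ℂ] A →ₗ[ℂ] D :=
  LinearMap.mk₂'ₛₗ (starRingEnd ℂ) (RingHom.id ℂ) (fun a a' => θ (star a * a'))
    (fun x y z => by rw [star_add, add_mul, map_add])
    (fun c x y => by rw [star_smul, smul_mul_assoc, map_smul, starRingEnd_apply])
    (fun x y z => by rw [mul_add, map_add])
    (fun c x y => by rw [mul_smul_comm, map_smul]; rfl)

lemma cpKernel_pos (θ : A →CP D) (n : ℕ) (v : Fin n → A) :
    0 ≤ CStarMatrix.ofMatrix (fun i j => cpKernel θ (v i) (v j)) :=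
  θ.map_cstarMatrix_nonneg' n _ ((HilbertModule.self A).gram_nonneg v)

/-- `A ⊙ D` with `⟨a ⊗ d | a' ⊗ d'⟩_D = d* θ(a* a') d'`. -/
def preCpTensor (θ : A →CP D) : PreCorrespondence A D :=
  kernelTensor (cpKernel θ) (Correspondence.self D)
    (fun v w => by
      change star (θ (star v * w)) = θ (star w * v)
      rw [← map_star θ, star_mul, star_star])
    (cpKernel_pos θ) (Algebra.lmul ℂ A) fun b v w => by
      change θ (star (b * v) * w) = θ (star v * (star b * w))
      rw [star_mul, mul_assoc]

/-- The correspondence `A ⊗_θ D` of a completely positive map `θ : A → D`. -/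
def cpTensor (θ : A →CP D) : Correspondence A D := (preCpTensor θ).toCorrespondence

/-- The class `[a ⊗ d]` in `A ⊗_θ D`. -/
def cpTmul (θ : A →CP D) (a : A) (d : D) : cpTensor θ :=
  (preCpTensor θ).cls (a ⊗ₜ[ℂ] d : A ⊗[ℂ] D)

end Tensor

/-- A Hilbert module with an algebraic left action by formally adjointable linear maps is a
correspondence; boundedness of the action is automatic. -/
def Correspondence.ofEnd (E : HilbertModule A) (f : B →ₐ[ℂ] Module.End ℂ E)
    (hf : ∀ b x y, E.ip (f b x) y = E.ip x (f (star b) y)) : Correspondence B A where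
  toHilbertModule := E
  lact :=
    have hb : ∀ b x, ‖f b x‖ ≤ ‖b‖ * ‖x‖ := fun b x => by
      let P : PreCorrespondence B A :=
        { carrier := E, form := E.ip, star_form := E.star_ip, form_self_nonneg := E.ip_self_nonneg
          ract := E.ract, form_ract := E.ip_ract, lact := f, form_lact := hf }
      have h : E.ip (f b x) (f b x) ≤ ((‖b‖ ^ 2 : ℝ) : ℂ) • E.ip x x := P.form_lact_le b x
      refine le_of_sq_le_sq ?_ (by positivity)
      rw [E.norm_sq, mul_pow, E.norm_sq]
      refine (CStarAlgebra.norm_le_norm_of_nonneg_of_le (E.ip_self_nonneg _) h).trans ?_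
      rw [norm_smul, Complex.norm_real, Real.norm_of_nonneg (by positivity)]
    { toFun := fun b => Adj.mk ((f b).mkContinuous ‖b‖ (hb b))
        ((f (star b)).mkContinuous ‖star b‖ (hb (star b))) (hf b)
      map_one' := Adj.ext fun x => by
        change f 1 x = x
        rw [map_one]; rfl
      map_mul' := fun a b => Adj.ext fun x => by
        change f (a * b) x = f a (f b x)
        rw [map_mul]; rfl
      map_zero' := Adj.ext fun x => by
        change f 0 x = 0
        rw [map_zero]; rfl
      map_add' := fun a b => Adj.ext fun x => by
        change f (a + b) x = f a x + f b x
        rw [map_add]; rfl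
      commutes' := fun c => Adj.ext fun x => by
        change f (algebraMap ℂ B c) x = c • x
        rw [AlgHom.commutes]; rfl
      map_star' := fun b => (Adj.star_eq_of (hf b)).symm }

lemma Correspondence.ip_lact (X : Correspondence B A) (b : B) (x y : X) :
    X.ip (X.lact b x) y = X.ip x (X.lact (star b) y) := by
  rw [map_star, Adj.ip_star]

section Sum

open DirectSum

variable {ι : Type} (X : ι → Correspondence B A)

/-- The form `⟨x | y⟩ = ∑ᵢ ⟨xᵢ | yᵢ⟩` on the algebraic direct sum. -/
def sumForm : (⨁ i, X i) →ₗ⋆[ℂ] (⨁ i, X i) →ₗ[ℂ] A := by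
  classical
  exact
  { toFun := fun x => DirectSum.toModule ℂ ι A fun i => (X i).ip (x i)
    map_add' := fun x y => DirectSum.linearMap_ext ℂ fun i => LinearMap.ext fun z => by
      simp [DirectSum.toModule_lof]
    map_smul' := fun c x => DirectSum.linearMap_ext ℂ fun i => LinearMap.ext fun z => by
      simp only [LinearMap.comp_apply, LinearMap.smul_apply, DirectSum.toModule_lof]
      rw [DirectSum.smul_apply, LinearMap.map_smulₛₗ, LinearMap.smul_apply] }

lemma sumForm_lof [inst : DecidableEq ι] (x : ⨁ i, X i) (i : ι) (y : X i) :
    sumForm X x (DirectSum.lof ℂ ι (fun i => (X i).carrier) i y) = (X i).ip (x i) y := by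
  obtain rfl : inst = fun a b => Classical.propDecidable (a = b) := Subsingleton.elim _ _
  classical
  exact DirectSum.toModule_lof (φ := fun i => (X i).ip (x i)) ℂ i y

lemma star_sumForm (x y : ⨁ i, X i) : star (sumForm X x y) = sumForm X y x := by
  classical
  induction y using DirectSum.induction_on with
  | zero => simp
  | add y z h h' => rw [map_add, star_add, h, h', map_add, LinearMap.add_apply]
  | of i y =>
    rw [← DirectSum.lof_eq_of ℂ, sumForm_lof, (X i).star_ip]
    induction x using DirectSum.induction_on with
    | zero => simp
    | add x z h h' => rw [DirectSum.add_apply, map_add, h, h', map_add]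
    | of j x =>
      rw [← DirectSum.lof_eq_of ℂ, sumForm_lof]
      by_cases hij : i = j
      · subst hij
        rw [DirectSum.lof_apply, DirectSum.lof_apply]
      · rw [DirectSum.lof_eq_of, DirectSum.lof_eq_of, DirectSum.of_eq_of_ne _ _ _ hij,
          DirectSum.of_eq_of_ne _ _ _ (Ne.symm hij)]
        simp

lemma sumForm_self_nonneg (x : ⨁ i, X i) : 0 ≤ sumForm X x x := by
  classical
  have h : sumForm X x x = ∑ i ∈ x.support, (X i).ip (x i) (x i) := by
    conv_lhs => enter [2]; rw [← DirectSum.sum_support_of x]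
    rw [map_sum]
    exact Finset.sum_congr rfl fun i _ => sumForm_lof X x i (x i)
  rw [h]
  exact Finset.sum_nonneg fun i _ => (X i).ip_self_nonneg _

/-- The algebraic direct sum of correspondences. -/
def preCorrespondenceSum : PreCorrespondence B A where
  carrier := ⨁ i, X i
  form := sumForm X
  star_form := star_sumForm X
  form_self_nonneg := sumForm_self_nonneg X
  ract a := DirectSum.lmap fun i => (X i).ract a
  form_ract x y a := by
    classical
    induction y using DirectSum.induction_on with
    | zero => simp
    | add y z h h' => rw [map_add, map_add, h, h', map_add, add_mul]
    | of i y =>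
      rw [← DirectSum.lof_eq_of ℂ, DirectSum.lmap_lof, sumForm_lof, sumForm_lof, (X i).ip_ract]
  lact :=
    { toFun := fun b => DirectSum.lmap fun i => (X i).lactEnd b
      map_one' := by
        refine LinearMap.ext fun x => DFinsupp.ext fun i => ?_
        change (X i).lactEnd 1 (x i) = x i
        rw [map_one]; rfl
      map_mul' := fun a b => by
        refine LinearMap.ext fun x => DFinsupp.ext fun i => ?_
        change (X i).lactEnd (a * b) (x i) = (X i).lactEnd a ((X i).lactEnd b (x i))
        rw [map_mul]; rfl
      map_zero' := by
        refine LinearMap.ext fun x => DFinsupp.ext fun i => ?_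
        change (X i).lactEnd 0 (x i) = 0
        rw [map_zero]; rfl
      map_add' := fun a b => by
        refine LinearMap.ext fun x => DFinsupp.ext fun i => ?_
        change (X i).lactEnd (a + b) (x i) = (X i).lactEnd a (x i) + (X i).lactEnd b (x i)
        rw [map_add]; rfl
      commutes' := fun c => by
        refine LinearMap.ext fun x => DFinsupp.ext fun i => ?_
        change (X i).lactEnd (algebraMap ℂ B c) (x i) = c • x i
        rw [AlgHom.commutes]; rfl }
  form_lact b x y := by
    classical
    change sumForm X (DirectSum.lmap (fun i => (X i).lactEnd b) x) y =
      sumForm X x (DirectSum.lmap (fun i => (X i).lactEnd (star b)) y)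
    induction y using DirectSum.induction_on with
    | zero => simp
    | add y z h h' => rw [map_add, h, h', map_add, map_add]
    | of i y =>
      rw [← DirectSum.lof_eq_of ℂ, DirectSum.lmap_lof, sumForm_lof, sumForm_lof]
      exact (X i).ip_lact b (x i) y

/-- The (completed) orthogonal direct sum of correspondences, with the diagonal left action. -/
def correspondenceSum : Correspondence B A := (preCorrespondenceSum X).toCorrespondence

open scoped Classical in
/-- The inclusion of the `i`-th summand. -/
def sumIncl (i : ι) (x : X i) : correspondenceSum X :=
  (preCorrespondenceSum X).cls
    (DirectSum.lof ℂ ι (fun i => (X i).carrier) i x : ⨁ i, (X i).carrier)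

lemma sumIncl_eq [inst : DecidableEq ι] (i : ι) (x : X i) :
    sumIncl X i x = (preCorrespondenceSum X).cls
      (DirectSum.lof ℂ ι (fun i => (X i).carrier) i x : ⨁ i, (X i).carrier) := by
  obtain rfl : inst = fun a b => Classical.propDecidable (a = b) := Subsingleton.elim _ _
  rfl

lemma ip_sumIncl_self (i : ι) (x y : X i) :
    (correspondenceSum X).ip (sumIncl X i x) (sumIncl X i y) = (X i).ip x y := by
  classical
  refine ((preCorrespondenceSum X).ip_cls _ _).trans ?_
  refine (sumForm_lof X _ i y).trans ?_
  rw [DirectSum.lof_apply]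

lemma ract_sumIncl (i : ι) (x : X i) (a : A) :
    (correspondenceSum X).ract a (sumIncl X i x) = sumIncl X i ((X i).ract a x) := by
  classical
  refine ((preCorrespondenceSum X).ract_cls _ _).trans ?_
  exact congrArg _ (DirectSum.lmap_lof (R := ℂ) (f := fun i => (X i).ract a) i x)

lemma lact_sumIncl (i : ι) (x : X i) (b : B) :
    (correspondenceSum X).lact b (sumIncl X i x) = sumIncl X i ((X i).lact b x) := by
  classical
  refine ((preCorrespondenceSum X).lact_cls _ _).trans ?_
  exact congrArg _ (DirectSum.lmap_lof (R := ℂ) (f := fun i => (X i).lactEnd b) i x)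

end Sum

/-! ### Rank one operators and corners -/

/-- The rank one operator `z ↦ x ◁ ⟨y | z⟩`. -/
def rankOneCLM (H : HilbertModule A) (x y : H) : H →L[ℂ] H :=
  LinearMap.mkContinuous
    { toFun := fun z => H.ract (H.ip y z) x
      map_add' := fun z w => by rw [map_add, H.ract_add]
      map_smul' := fun c z => by rw [map_smul, H.ract_smul]; rfl } (‖x‖ * ‖y‖) fun z => by
    refine (H.norm_ract_le x _).trans ?_
    calc ‖H.ip y z‖ * ‖x‖ ≤ ‖y‖ * ‖z‖ * ‖x‖ := by gcongr; exact H.norm_ip_le y z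
      _ = _ := by ring

/-- The rank one operator `z ↦ x ◁ ⟨y | z⟩`, an adjointable operator. -/
def rankOne (H : HilbertModule A) (x y : H) : Adj H :=
  Adj.mk (rankOneCLM H x y) (rankOneCLM H y x) fun z w => by
    change H.ip (H.ract (H.ip y z) x) w = H.ip z (H.ract (H.ip x w) y)
    rw [H.ract_ip, H.ip_ract, H.star_ip]

lemma rankOne_apply (H : HilbertModule A) (x y z : H) : rankOne H x y z = H.ract (H.ip y z) x := rfl

lemma rankOne_mul_rankOne (H : HilbertModule A) (x y z w : H) :
    rankOne H x y * rankOne H z w = rankOne H (H.ract (H.ip y z) x) w :=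
  Adj.ext fun v => by
    rw [Adj.mul_apply, rankOne_apply, rankOne_apply, rankOne_apply, H.ip_ract, H.ract_mul]

section Corner

variable {H : HilbertModule A}

lemma Correspondence.lact_ract (X : Correspondence B A) (b : B) (a : A) (x : X) :
    X.lact b (X.ract a x) = X.ract a (X.lact b x) := Adj.apply_ract _ _ _

/-- The submodule `X ◁ (e ⊗ e*)`, where `e ⊗ e*` is the rank one projection at `e`. -/
def cornerSubmodule (X : HilbertModule (Adj H)) (e : H) : Submodule ℂ X :=
  LinearMap.range (X.ract (rankOne H e e))

variable {e : H}

lemma rankOne_mul_self (he : H.ip e e = 1) (x : H) : rankOne H x e * rankOne H e e = rankOne H x e := by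
  rw [rankOne_mul_rankOne, he, H.ract_one]

lemma mem_cornerSubmodule (he : H.ip e e = 1) (X : HilbertModule (Adj H)) (x : X) :
    x ∈ cornerSubmodule X e ↔ X.ract (rankOne H e e) x = x := by
  refine ⟨?_, fun h => ⟨x, h⟩⟩
  rintro ⟨y, rfl⟩
  rw [← X.ract_mul, rankOne_mul_self he]

lemma isClosed_cornerSubmodule (he : H.ip e e = 1) (X : HilbertModule (Adj H)) :
    IsClosed (cornerSubmodule X e : Set X) := by
  have : (cornerSubmodule X e : Set X) = {x | X.ract (rankOne H e e) x = x} :=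
    Set.ext fun x => mem_cornerSubmodule he X x
  rw [this]
  exact isClosed_eq (X.continuous_ract _) continuous_id

lemma norm_le_one (he : H.ip e e = 1) : ‖e‖ ≤ 1 := by
  have h : ‖e‖ ^ 2 ≤ 1 := by
    rw [H.norm_sq, he]
    have : ‖(1 : A)‖ * ‖(1 : A)‖ = ‖(1 : A)‖ := by
      rw [← CStarRing.norm_star_mul_self, star_one, one_mul]
    by_contra hn
    push Not at hn
    nlinarith
  nlinarith [norm_nonneg e]

lemma corner_norm_sq (he : H.ip e e = 1) (X : HilbertModule (Adj H)) (x : cornerSubmodule X e) :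
    ‖x‖ ^ 2 = ‖H.ip e (X.ip (x : X) (x : X) e)‖ := by
  have h1 := norm_le_one he
  have hx := (mem_cornerSubmodule he X (x : X)).1 x.2
  set c := X.ip (x : X) (x : X) with hc
  have hc1 : c * rankOne H e e = c := by rw [hc, ← X.ip_ract, hx]
  have hc2 : star (rankOne H e e) * c = c := by rw [hc, ← X.ract_ip, hx]
  have hst : star (rankOne H e e) = rankOne H e e :=
    Adj.star_eq_of fun z w => by
      rw [rankOne_apply, rankOne_apply, H.ract_ip, H.ip_ract, H.star_ip]
  rw [hst] at hc2
  have hn : ‖x‖ ^ 2 = ‖c‖ := X.norm_sq (x : X)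
  rw [hn]
  refine le_antisymm ?_ ?_
  · rw [Adj.norm_def]
    refine ContinuousLinearMap.opNorm_le_bound _ (norm_nonneg _) fun z => ?_
    have hz : c z = H.ract (H.ip e (c e) * H.ip e z) e := by
      conv_lhs => rw [← hc2, ← hc1]
      rw [Adj.mul_apply, Adj.mul_apply, rankOne_apply, rankOne_apply, Adj.apply_ract, H.ip_ract]
    rw [hz]
    refine (H.norm_ract_le _ _).trans ?_
    calc ‖H.ip e (c e) * H.ip e z‖ * ‖e‖ ≤ ‖H.ip e (c e)‖ * (‖e‖ * ‖z‖) * ‖e‖ := by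
            gcongr
            exact (norm_mul_le _ _).trans (by gcongr; exact H.norm_ip_le e z)
      _ ≤ ‖H.ip e (c e)‖ * (1 * ‖z‖) * 1 := by gcongr
      _ = _ := by ring
  · refine (H.norm_ip_le _ _).trans ?_
    calc ‖e‖ * ‖c e‖ ≤ ‖e‖ * (‖c‖ * ‖e‖) := by gcongr; exact (Adj.toCLM c).le_opNorm e
      _ ≤ 1 * (‖c‖ * 1) := by gcongr
      _ = _ := by ring

/-- The right Hilbert `A`-module `X ◁ (e ⊗ e*)`, for a Hilbert module `X` over `End†(H_A)` and a
unit vector `e` of `H`. On it, the inner product of `X` takes values in the corner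
`{x : x = (e ⊗ e*) x (e ⊗ e*)} ≅ A`, and the `A`-valued inner product is the corresponding matrix
entry `⟨e | ⟨x | y⟩ e⟩`. The right action of `a` is that of the operator `e ◁ a ⊗ e*`. -/
def cornerModule (he : H.ip e e = 1) (X : HilbertModule (Adj H)) : HilbertModule A where
  carrier := cornerSubmodule X e
  completeSpace := (isClosed_cornerSubmodule he X).completeSpace_coe
  ip := LinearMap.mk₂'ₛₗ (starRingEnd ℂ) (RingHom.id ℂ)
    (fun x y => H.ip e (X.ip (x : X) (y : X) e))
    (fun x y z => by
      rw [Submodule.coe_add, map_add, LinearMap.add_apply, Adj.add_apply, map_add])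
    (fun c x y => by
      rw [Submodule.coe_smul, LinearMap.map_smulₛₗ X.ip, LinearMap.smul_apply, Adj.smul_apply,
        map_smul])
    (fun x y z => by rw [Submodule.coe_add, map_add, Adj.add_apply, map_add])
    (fun c x y => by rw [Submodule.coe_smul, map_smul, Adj.smul_apply, map_smul]; rfl)
  star_ip x y := by
    simp only [LinearMap.mk₂'ₛₗ_apply]
    rw [H.star_ip, ← Adj.ip_star, X.star_ip]
  ip_self_nonneg x := by
    simp only [LinearMap.mk₂'ₛₗ_apply]
    obtain ⟨R, hR⟩ := exists_eq_star_mul_self (X.ip_self_nonneg (x : X))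
    rw [hR, Adj.mul_apply, Adj.ip_star]
    exact H.ip_self_nonneg _
  norm_sq x := corner_norm_sq he X x
  ract a := ((X.ract (rankOne H (H.ract a e) e)).comp (Submodule.subtype _)).codRestrict _ fun x => by
    rw [mem_cornerSubmodule he, LinearMap.comp_apply, ← X.ract_mul, rankOne_mul_self he]
  ip_ract x y a := by
    simp only [LinearMap.mk₂'ₛₗ_apply]
    rw [LinearMap.codRestrict_apply, LinearMap.comp_apply, Submodule.subtype_apply, X.ip_ract,
      Adj.mul_apply, rankOne_apply, he, H.ract_one, Adj.apply_ract, H.ip_ract]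

/-- `X ◁ (e ⊗ e*)` as a correspondence, with the left action of `X`. -/
def cornerCorrespondence (he : H.ip e e = 1) (X : Correspondence B (Adj H)) : Correspondence B A :=
  have hinv : ∀ b, ∀ x ∈ cornerSubmodule X.toHilbertModule e,
      X.lactEnd b x ∈ cornerSubmodule X.toHilbertModule e := fun b x hx => by
    rw [mem_cornerSubmodule he] at hx ⊢
    change X.ract _ (X.lact b x) = X.lact b x
    rw [← X.lact_ract, hx]
  Correspondence.ofEnd (cornerModule he X.toHilbertModule)
    { toFun := fun b => (X.lactEnd b).restrict (hinv b)
      map_one' := LinearMap.ext fun x => Subtype.ext <| by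
        change X.lactEnd 1 x.1 = x.1
        rw [map_one]; rfl
      map_mul' := fun a b => LinearMap.ext fun x => Subtype.ext <| by
        change X.lactEnd (a * b) x.1 = X.lactEnd a (X.lactEnd b x.1)
        rw [map_mul]; rfl
      map_zero' := LinearMap.ext fun x => Subtype.ext <| by
        change X.lactEnd 0 x.1 = 0
        rw [map_zero]; rfl
      map_add' := fun a b => LinearMap.ext fun x => Subtype.ext <| by
        change X.lactEnd (a + b) x.1 = X.lactEnd a x.1 + X.lactEnd b x.1
        rw [map_add]; rfl
      commutes' := fun c => LinearMap.ext fun x => Subtype.ext <| by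
        change X.lactEnd (algebraMap ℂ B c) x.1 = c • x.1
        rw [AlgHom.commutes]; rfl }
    fun b x y => by
      change H.ip e (X.ip (X.lact b x.1) y.1 e) = H.ip e (X.ip x.1 (X.lact (star b) y.1) e)
      rw [X.ip_lact]

end Corner

/-! ### Creation operators and the Fock space -/

section Box

variable {D L : Type u} [CStarAlgebra D] [PartialOrder D] [StarOrderedRing D] [CStarAlgebra L]
  (X : Correspondence L D) (Y : Correspondence D A)

/-- `y ↦ x ⊠ y`. -/
def boxLeft (x : X) : Y →ₗ[ℂ] interiorTensor X Y :=
  (preInteriorTensor X Y).cls ∘ₗ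
    (TensorProduct.mk ℂ X.carrier Y.carrier x : Y.carrier →ₗ[ℂ] (preInteriorTensor X Y).carrier)

/-- `x' ⊗ y ↦ ⟨x | x'⟩ ▷ y` on the algebraic tensor product. -/
def annihAlg (x : X) : (preInteriorTensor X Y).carrier →ₗ[ℂ] Y :=
  TensorProduct.lift (LinearMap.mk₂ ℂ (fun (x' : X) (y : Y) => Y.lact (X.ip x x') y)
    (fun a b y' => by rw [map_add, map_add, Adj.add_apply])
    (fun c a y' => by rw [map_smul, map_smul, Adj.smul_apply])
    (fun a y' z' => by rw [map_add])
    (fun c a y' => by rw [map_smul]))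

lemma annihAlg_tmul (x x' : X) (y : Y) :
    annihAlg X Y x (x' ⊗ₜ[ℂ] y : X.carrier ⊗[ℂ] Y.carrier) = Y.lact (X.ip x x') y := rfl

lemma form_tmul_left (x : X) (y : Y) (z : X.carrier ⊗[ℂ] Y.carrier) :
    kernelForm X.ip Y (x ⊗ₜ y) z = Y.ip y (annihAlg X Y x z) := by
  induction z with
  | zero => rw [map_zero]; exact ((congrArg _ (map_zero (annihAlg X Y x))).trans (map_zero _)).symm
  | add z w h h' =>
    rw [map_add, h, h', ← map_add]
    exact congrArg _ (map_add (annihAlg X Y x) z w).symm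
  | tmul x' y' => rfl

lemma annihAlg_bound (x : X) (z : preInteriorTensor X Y) :
    ‖annihAlg X Y x z‖ ≤ ‖x‖ * ‖z‖ := by
  set w := annihAlg X Y x z with hw
  let t : preInteriorTensor X Y := (x ⊗ₜ[ℂ] w : X.carrier ⊗[ℂ] Y.carrier)
  have h1 : Y.ip w w = (preInteriorTensor X Y).form t z := (form_tmul_left X Y x w z).symm
  have h2 : ‖t‖ ≤ ‖x‖ * ‖w‖ := by
    refine le_of_sq_le_sq ?_ (by positivity)
    have h3 : ‖t‖ ^ 2 = ‖Y.ip w (Y.lact (X.ip x x) w)‖ := (preInteriorTensor X Y).norm_sq t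
    rw [h3, mul_pow, X.norm_sq]
    calc _ ≤ ‖w‖ * ‖Y.lact (X.ip x x) w‖ := Y.norm_ip_le _ _
      _ ≤ ‖w‖ * (‖Y.lact (X.ip x x)‖ * ‖w‖) := by
          gcongr; exact (Adj.toCLM (Y.lact (X.ip x x))).le_opNorm w
      _ ≤ ‖w‖ * (‖X.ip x x‖ * ‖w‖) := by
          gcongr; exact NonUnitalStarAlgHom.norm_apply_le Y.lact _
      _ = _ := by ring
  have h4 : ‖w‖ ^ 2 ≤ ‖x‖ * ‖w‖ * ‖z‖ := by
    rw [Y.norm_sq, h1]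
    exact ((preInteriorTensor X Y).norm_form_le t z).trans (by gcongr)
  rcases (norm_nonneg w).eq_or_lt with h0 | h0
  · rw [← h0]; positivity
  · nlinarith

/-- The bounded operator `X ⊠ Y → Y` with `x' ⊠ y ↦ ⟨x | x'⟩ ▷ y`. -/
def annih (x : X) : interiorTensor X Y →L[ℂ] Y :=
  ((annihAlg X Y x).mkContinuous ‖x‖ (annihAlg_bound X Y x)).extend
    (Completion.toComplL (𝕜 := ℂ) (E := (preInteriorTensor X Y).carrier))

lemma annih_cls (x : X) (z : preInteriorTensor X Y) :
    annih X Y x ((preInteriorTensor X Y).cls z) = annihAlg X Y x z :=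
  ContinuousLinearMap.extend_eq _ Completion.denseRange_coe
    (Completion.isUniformInducing_coe _) z

lemma ip_boxLeft (x : X) (y : Y) (z : interiorTensor X Y) :
    (interiorTensor X Y).ip (boxLeft X Y x y) z = Y.ip y (annih X Y x z) := by
  refine congrFun ((preInteriorTensor X Y).denseRange_cls.equalizer
    ((interiorTensor X Y).continuous_ip' continuous_const continuous_id)
    (Y.continuous_ip' continuous_const (annih X Y x).continuous) (funext fun z => ?_)) z
  change (interiorTensor X Y).ip _ ((preInteriorTensor X Y).cls z) =
    Y.ip y (annih X Y x ((preInteriorTensor X Y).cls z))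
  rw [annih_cls]
  exact ((preInteriorTensor X Y).ip_cls _ _).trans (form_tmul_left X Y x y z)

lemma annih_boxLeft (x x' : X) (y : Y) :
    annih X Y x (boxLeft X Y x' y) = Y.lact (X.ip x x') y :=
  annih_cls X Y x _

end Box

section Fock

open DirectSum

variable (T : Correspondence A A)

/-- `T^{⊠ d}`, with `T^{⊠ 0} = A`. -/
def tensorPow : ℕ → Correspondence A A
  | 0 => Correspondence.self A
  | d + 1 => interiorTensor T (tensorPow d)

/-- The Fock space `𝓕(T)`, the completed direct sum of all `T^{⊠ d}`. -/
def fock : Correspondence A A := correspondenceSum (tensorPow T)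

/-- `1 ∈ A = T^{⊠ 0}`. -/
def onePow : tensorPow T 0 := (1 : A)

/-- The vacuum vector `1̂`. -/
def vacuum : fock T := sumIncl (tensorPow T) 0 (onePow T)

/-- `η ↦ ξ ⊠ η` from `T^{⊠ d}` to `T^{⊠ (d+1)}`. -/
def raise (ξ : T) (d : ℕ) : tensorPow T d →ₗ[ℂ] tensorPow T (d + 1) := boxLeft T (tensorPow T d) ξ

/-- `ζ ⊠ η ↦ ⟨ξ | ζ⟩ ▷ η` from `T^{⊠ (d+1)}` to `T^{⊠ d}`. -/
def lower (ξ : T) (d : ℕ) : tensorPow T (d + 1) →ₗ[ℂ] tensorPow T d :=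
  (annih T (tensorPow T d) ξ).toLinearMap

lemma ip_raise (ξ : T) (d : ℕ) (x : tensorPow T d) (y : tensorPow T (d + 1)) :
    (tensorPow T (d + 1)).ip (raise T ξ d x) y = (tensorPow T d).ip x (lower T ξ d y) :=
  ip_boxLeft T (tensorPow T d) ξ x y

lemma lower_raise (ξ : T) (d : ℕ) (x : tensorPow T d) :
    lower T ξ d (raise T ξ d x) = (tensorPow T d).lactEnd (T.ip ξ ξ) x :=
  annih_boxLeft T (tensorPow T d) ξ ξ x

/-- `η ↦ ξ ⊠ η` on the algebraic direct sum, raising the degree by one. -/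
def creationAlg (ξ : T) : (⨁ d, tensorPow T d) →ₗ[ℂ] ⨁ d, tensorPow T d :=
  DirectSum.toModule ℂ ℕ _ fun d =>
    DirectSum.lof ℂ ℕ (fun d => (tensorPow T d).carrier) (d + 1) ∘ₗ raise T ξ d

/-- The degree `d` component of `annihilationAlg`. -/
def annihilationAux (ξ : T) : (d : ℕ) → tensorPow T d →ₗ[ℂ] ⨁ d, tensorPow T d
  | 0 => 0
  | d + 1 => DirectSum.lof ℂ ℕ (fun d => (tensorPow T d).carrier) d ∘ₗ lower T ξ d

/-- The formal adjoint of `creationAlg`: it kills degree zero, and is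
`ζ ⊠ η ↦ ⟨ξ | ζ⟩ ▷ η` in positive degree. -/
def annihilationAlg (ξ : T) : (⨁ d, tensorPow T d) →ₗ[ℂ] ⨁ d, tensorPow T d :=
  DirectSum.toModule ℂ ℕ _ (annihilationAux T ξ)

lemma creationAlg_lof (ξ : T) (d : ℕ) (x : tensorPow T d) :
    creationAlg T ξ (DirectSum.lof ℂ ℕ (fun d => (tensorPow T d).carrier) d x) =
      DirectSum.lof ℂ ℕ (fun d => (tensorPow T d).carrier) (d + 1) (raise T ξ d x) := by
  rw [creationAlg, DirectSum.toModule_lof, LinearMap.comp_apply]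

lemma annihilationAlg_lof_zero (ξ : T) (x : tensorPow T 0) :
    annihilationAlg T ξ (DirectSum.lof ℂ ℕ (fun d => (tensorPow T d).carrier) 0 x) = 0 := by
  rw [annihilationAlg, DirectSum.toModule_lof]; rfl

lemma annihilationAlg_lof_succ (ξ : T) (d : ℕ) (x : tensorPow T (d + 1)) :
    annihilationAlg T ξ (DirectSum.lof ℂ ℕ (fun d => (tensorPow T d).carrier) (d + 1) x) =
      DirectSum.lof ℂ ℕ (fun d => (tensorPow T d).carrier) d (lower T ξ d x) := by
  rw [annihilationAlg, DirectSum.toModule_lof]; rfl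

lemma sumForm_lof_lof_of_ne {i j : ℕ} (h : i ≠ j) (x : tensorPow T i) (y : tensorPow T j) :
    sumForm (tensorPow T) (DirectSum.lof ℂ ℕ (fun d => (tensorPow T d).carrier) i x)
      (DirectSum.lof ℂ ℕ (fun d => (tensorPow T d).carrier) j y) = 0 := by
  rw [sumForm_lof, DirectSum.lof_eq_of, DirectSum.of_eq_of_ne _ _ _ (Ne.symm h), map_zero,
    LinearMap.zero_apply]

lemma form_creationAlg (ξ : T) (x y : ⨁ d, tensorPow T d) :
    sumForm (tensorPow T) (creationAlg T ξ x) y =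
      sumForm (tensorPow T) x (annihilationAlg T ξ y) := by
  induction x using DirectSum.induction_on with
  | zero => simp
  | add x z h h' => simp only [map_add, LinearMap.add_apply, h, h']
  | of i x =>
    induction y using DirectSum.induction_on with
    | zero => simp
    | add y z h h' => simp only [map_add, h, h']
    | of j y =>
      rw [← DirectSum.lof_eq_of ℂ, ← DirectSum.lof_eq_of ℂ, creationAlg_lof]
      rcases j with _ | j
      · rw [annihilationAlg_lof_zero, map_zero, sumForm_lof_lof_of_ne _ (by omega)]
      · rw [annihilationAlg_lof_succ]
        by_cases hij : i = j
        · subst hij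
          rw [sumForm_lof, sumForm_lof, DirectSum.lof_apply, DirectSum.lof_apply]
          exact ip_raise T ξ i x y
        · rw [sumForm_lof_lof_of_ne _ (by omega), sumForm_lof_lof_of_ne _ hij]

lemma annihilationAlg_creationAlg (ξ : T) (x : ⨁ d, tensorPow T d) :
    annihilationAlg T ξ (creationAlg T ξ x) =
      (preCorrespondenceSum (tensorPow T)).lact (T.ip ξ ξ) x := by
  change _ = DirectSum.lmap (fun d => (tensorPow T d).lactEnd (T.ip ξ ξ)) x
  induction x using DirectSum.induction_on with
  | zero => simp
  | add x z h h' => simp only [map_add, h, h']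
  | of i x =>
    rw [← DirectSum.lof_eq_of ℂ, creationAlg_lof, annihilationAlg_lof_succ, DirectSum.lmap_lof,
      lower_raise]

/-- `creationAlg` on the semi-inner-product module `⨁ T^{⊠ d}`. -/
def creationPre (ξ : T) :
    (preCorrespondenceSum (tensorPow T)).carrier →ₗ[ℂ]
      (preCorrespondenceSum (tensorPow T)).carrier := creationAlg T ξ

/-- `annihilationAlg` on the semi-inner-product module `⨁ T^{⊠ d}`. -/
def annihilationPre (ξ : T) :
    (preCorrespondenceSum (tensorPow T)).carrier →ₗ[ℂ]
      (preCorrespondenceSum (tensorPow T)).carrier := annihilationAlg T ξ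

lemma form_creationPre (ξ : T) (x y : preCorrespondenceSum (tensorPow T)) :
    (preCorrespondenceSum (tensorPow T)).form (creationPre T ξ x) y =
      (preCorrespondenceSum (tensorPow T)).form x (annihilationPre T ξ y) :=
  form_creationAlg T ξ x y

lemma creationPre_bound (ξ : T) : ∃ C : ℝ, ∀ x : preCorrespondenceSum (tensorPow T),
    ‖creationPre T ξ x‖ ≤ C * ‖x‖ := by
  refine ⟨‖ξ‖, fun x => le_of_sq_le_sq ?_ (by positivity)⟩
  have h1 : annihilationPre T ξ (creationPre T ξ x) =
    (preCorrespondenceSum (tensorPow T)).lact (T.ip ξ ξ) x := annihilationAlg_creationAlg T ξ x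
  rw [PreHilbertModule.norm_sq, form_creationPre, h1, mul_pow, T.norm_sq]
  refine (PreHilbertModule.norm_form_le _ _ _).trans ?_
  nlinarith [norm_nonneg x, PreCorrespondence.norm_lact_le _ (T.ip ξ ξ) x]

/-- The creation operator `ℓ(ξ)` on the Fock space. -/
def creation (ξ : T) : Adj (fock T).toHilbertModule :=
  (preCorrespondenceSum (tensorPow T)).extendAdj (creationPre T ξ) (annihilationPre T ξ)
    (creationPre_bound T ξ) (form_creationPre T ξ)

/-- `ℓ(ξ) + ℓ(ξ)*`. -/
def semicircular (ξ : T) : Adj (fock T).toHilbertModule := creation T ξ + star (creation T ξ)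

variable {T} {I : Type} (ξ : I → T)

/-- The C*-algebra generated by `A` (acting diagonally on the left) and the operators
`X_i = ℓ(ξ_i) + ℓ(ξ_i)*` in `End†(𝓕(T)_A)`. -/
def semicircularSubalgebra : StarSubalgebra ℂ (Adj (fock T).toHilbertModule) :=
  (StarAlgebra.adjoin ℂ
    (Set.range (fock T).lact ∪ Set.range fun i => semicircular T (ξ i))).topologicalClosure

/-- The same, as a C*-algebra. -/
def SemicircularAlgebra : Type u := semicircularSubalgebra ξ

namespace SemicircularAlgebra

instance : CStarAlgebra (SemicircularAlgebra ξ) :=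
  StarSubalgebra.cstarAlgebra (semicircularSubalgebra ξ)
    (h_closed := StarSubalgebra.isClosed_topologicalClosure _)

/-- The inclusion into `End†(𝓕(T)_A)`. -/
def incl : SemicircularAlgebra ξ →⋆ₐ[ℂ] Adj (fock T).toHilbertModule :=
  (semicircularSubalgebra ξ).subtype

/-- The inclusion of `A`. -/
def ofA : A →⋆ₐ[ℂ] SemicircularAlgebra ξ :=
  StarAlgHom.codRestrict (fock T).lact (semicircularSubalgebra ξ) fun a =>
    StarSubalgebra.le_topologicalClosure _ (StarAlgebra.subset_adjoin ℂ _ (.inl ⟨a, rfl⟩))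

/-- The generator `X_i`. -/
def gen (i : I) : SemicircularAlgebra ξ :=
  ⟨semicircular T (ξ i),
    StarSubalgebra.le_topologicalClosure _ (StarAlgebra.subset_adjoin ℂ _ (.inr ⟨i, rfl⟩))⟩

/-- `E(x) = ⟨1̂ | x 1̂⟩`. -/
def condExp : SemicircularAlgebra ξ →ₗ[ℂ] A where
  toFun x := (fock T).ip (vacuum T) (incl ξ x (vacuum T))
  map_add' x y := by rw [map_add, Adj.add_apply, map_add]
  map_smul' c x := by rw [map_smul, Adj.smul_apply, map_smul]; rfl

lemma condExp_star_mul (x y : SemicircularAlgebra ξ) :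
    condExp ξ (star x * y) = (fock T).ip (incl ξ x (vacuum T)) (incl ξ y (vacuum T)) := by
  change (fock T).ip (vacuum T) (incl ξ (star x * y) (vacuum T)) = _
  rw [map_mul, map_star, Adj.mul_apply, Adj.ip_star]

lemma lact_vacuum (a : A) : (fock T).lact a (vacuum T) = (fock T).ract a (vacuum T) := by
  refine (lact_sumIncl (tensorPow T) 0 _ a).trans
    (Eq.trans ?_ (ract_sumIncl (tensorPow T) 0 _ a).symm)
  refine congrArg (sumIncl (tensorPow T) 0) ?_
  change a * (1 : A) = (1 : A) * a
  rw [one_mul, mul_one]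

/-- `𝓕(T)` as a correspondence from the generated C*-algebra to `A`. -/
def fockCorrespondence : Correspondence (SemicircularAlgebra ξ) A where
  toHilbertModule := (fock T).toHilbertModule
  lact := incl ξ

/-- The C*-algebra with `⟨x | y⟩ = E(x* y)`, `b ▷ x = b x`, `x ◁ a = x a`. -/
def preGns : PreCorrespondence (SemicircularAlgebra ξ) A where
  carrier := SemicircularAlgebra ξ
  form := LinearMap.mk₂'ₛₗ (starRingEnd ℂ) (RingHom.id ℂ) (fun x y => condExp ξ (star x * y))
    (fun x y z => by rw [star_add, add_mul, map_add])
    (fun c x y => by rw [star_smul, smul_mul_assoc, map_smul, starRingEnd_apply])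
    (fun x y z => by rw [mul_add, map_add])
    (fun c x y => by rw [mul_smul_comm, map_smul]; rfl)
  star_form x y := by
    simp only [LinearMap.mk₂'ₛₗ_apply, condExp_star_mul]
    exact (fock T).star_ip _ _
  form_self_nonneg x := by
    simp only [LinearMap.mk₂'ₛₗ_apply, condExp_star_mul]
    exact (fock T).ip_self_nonneg _
  ract a := LinearMap.mulRight ℂ (ofA ξ a)
  form_ract x y a := by
    simp only [LinearMap.mk₂'ₛₗ_apply, LinearMap.mulRight_apply, condExp_star_mul]
    rw [map_mul, Adj.mul_apply]
    change (fock T).ip _ (incl ξ y ((fock T).lact a (vacuum T))) = _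
    rw [lact_vacuum, Adj.apply_ract, (fock T).ip_ract]
  lact := Algebra.lmul ℂ (SemicircularAlgebra ξ)
  form_lact b x y := by
    change condExp ξ (star (b * x) * y) = condExp ξ (star x * (star b * y))
    rw [star_mul, mul_assoc]

/-- The GNS correspondence of `E`: the completion of `{x Ω}` for `⟨x Ω | y Ω⟩ = E(x* y)`. -/
def gns : Correspondence (SemicircularAlgebra ξ) A := (preGns ξ).toCorrespondence

/-- `x ↦ x Ω`. -/
def toGns : SemicircularAlgebra ξ →ₗ[ℂ] gns ξ := (preGns ξ).cls

end SemicircularAlgebra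

end Fock

/-! ### Sub-correspondences and isomorphisms -/

/-- Restriction of the left action along a homomorphism. -/
def Correspondence.restrictLeft {C : Type u} [CStarAlgebra C] (φ : C →⋆ₐ[ℂ] B)
    (X : Correspondence B A) : Correspondence C A where
  toHilbertModule := X.toHilbertModule
  lact := X.lact.comp φ

section Generated

variable (X : Correspondence B A) (x : X)

/-- The closed linear span of `B ▷ x ◁ A`. -/
def generatedSubmodule : Submodule ℂ X :=
  (Submodule.span ℂ {y | ∃ b a, y = X.lact b (X.ract a x)}).topologicalClosure

variable {X x} in
lemma generatedSubmodule_invariant (f : X →ₗ[ℂ] X) (hf : Continuous f)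
    (h : ∀ b a, ∃ b' a', f (X.lact b (X.ract a x)) = X.lact b' (X.ract a' x)) :
    ∀ y ∈ generatedSubmodule X x, f y ∈ generatedSubmodule X x := by
  have h1 : Set.MapsTo f (Submodule.span ℂ {y | ∃ b a, y = X.lact b (X.ract a x)} : Set X)
      (Submodule.span ℂ {y | ∃ b a, y = X.lact b (X.ract a x)} : Set X) := by
    intro y hy
    induction hy using Submodule.span_induction with
    | mem y hy =>
      obtain ⟨b, a, rfl⟩ := hy
      obtain ⟨b', a', h'⟩ := h b a
      exact Submodule.subset_span ⟨b', a', h'⟩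
    | zero => rw [map_zero]; exact Submodule.zero_mem _
    | add y z _ _ hy hz => rw [map_add]; exact Submodule.add_mem _ hy hz
    | smul c y _ hy => rw [map_smul]; exact Submodule.smul_mem _ c hy
  exact h1.closure hf

/-- The underlying Hilbert module of `generated X x`. -/
def generatedModule : HilbertModule A where
  carrier := generatedSubmodule X x
  completeSpace := (Submodule.isClosed_topologicalClosure _).completeSpace_coe
  ip := (X.ip.domRestrict₁₂ (generatedSubmodule X x) (generatedSubmodule X x))
  star_ip y z := X.star_ip y.1 z.1
  ip_self_nonneg y := X.ip_self_nonneg y.1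
  norm_sq y := X.norm_sq y.1
  ract a := (X.ract a).restrict <| generatedSubmodule_invariant _ (X.continuous_ract a)
    fun b a' => ⟨b, a' * a, by rw [← X.lact_ract, X.ract_mul]⟩
  ip_ract y z a := X.ip_ract y.1 z.1 a

/-- The closed sub-correspondence of `X` generated by `x`, i.e. the closed linear span of
`B ▷ x ◁ A`. -/
def generated : Correspondence B A :=
  have hinv : ∀ b, ∀ y ∈ generatedSubmodule X x, X.lactEnd b y ∈ generatedSubmodule X x :=
    fun b => generatedSubmodule_invariant _ (X.lact b).continuous_apply fun b' a =>
      ⟨b * b', a, by rw [map_mul]; rfl⟩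
  Correspondence.ofEnd (generatedModule X x)
    { toFun := fun b => (X.lactEnd b).restrict (hinv b)
      map_one' := LinearMap.ext fun x => Subtype.ext <| by
        change X.lactEnd 1 x.1 = x.1
        rw [map_one]; rfl
      map_mul' := fun a b => LinearMap.ext fun x => Subtype.ext <| by
        change X.lactEnd (a * b) x.1 = X.lactEnd a (X.lactEnd b x.1)
        rw [map_mul]; rfl
      map_zero' := LinearMap.ext fun x => Subtype.ext <| by
        change X.lactEnd 0 x.1 = 0
        rw [map_zero]; rfl
      map_add' := fun a b => LinearMap.ext fun x => Subtype.ext <| by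
        change X.lactEnd (a + b) x.1 = X.lactEnd a x.1 + X.lactEnd b x.1
        rw [map_add]; rfl
      commutes' := fun c => LinearMap.ext fun x => Subtype.ext <| by
        change X.lactEnd (algebraMap ℂ B c) x.1 = c • x.1
        rw [AlgHom.commutes]; rfl }
    fun b y z => X.ip_lact b y.1 z.1

end Generated

/-- An isometric isomorphism of right correspondences. -/
structure Correspondence.Iso (X Y : Correspondence B A) where
  toEquiv : X ≃ₗᵢ[ℂ] Y
  map_ip : ∀ x y, Y.ip (toEquiv x) (toEquiv y) = X.ip x y
  map_lact : ∀ b x, toEquiv (X.lact b x) = Y.lact b (toEquiv x)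
  map_ract : ∀ a x, toEquiv (X.ract a x) = Y.ract a (toEquiv x)

/-! ### Covariance matrices -/

section Covariance

variable (A) (I : Type)

/-- The standard Hilbert module `ℓ²(I) ⊗ A`, with diagonal left action of `A`. -/
def stdModule : Correspondence A A := correspondenceSum fun _ : I => Correspondence.self A

variable {I}

/-- The vector `δ_i ⊗ 1` of `ℓ²(I) ⊗ A`. -/
def stdVec (i : I) : stdModule A I := sumIncl (fun _ : I => Correspondence.self A) i (1 : A)

lemma ip_stdVec_self (i : I) : (stdModule A I).ip (stdVec A i) (stdVec A i) = 1 := by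
  refine (ip_sumIncl_self _ _ _ _).trans ?_
  change star (1 : A) * 1 = 1
  rw [star_one, one_mul]

variable (I) in
/-- The C*-algebra `End†(ℓ²(I) ⊗ A)` of all `I × I` matrices over `A` that define adjointable
operators. It contains the spatial tensor product `A ⊗ B(ℓ²(I))`, as the closed span of the
operators `a ⊗ x`. -/
abbrev MatrixAlgebra : Type u := Adj (stdModule A I).toHilbertModule

/-- The matrix unit `1 ⊗ e_{ij}`, `z ↦ (δ_i ⊗ 1) ◁ ⟨δ_j ⊗ 1 | z⟩`. -/
def matrixUnit (i j : I) : MatrixAlgebra A I :=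
  rankOne (stdModule A I).toHilbertModule (stdVec A i) (stdVec A j)

variable {A}

/-- Compression of a completely positive map to `End†(H)` by a vector `e` is completely
positive. -/
def compress {H : HilbertModule A} (θ : A →CP Adj H) (e : H) : A →CP A where
  toFun a := H.ip e (θ a e)
  map_add' a b := by rw [map_add, Adj.add_apply, map_add]
  map_smul' c a := by rw [map_smul, Adj.smul_apply, map_smul]; rfl
  map_cstarMatrix_nonneg' k M hM := by
    obtain ⟨R, hR⟩ := exists_eq_star_mul_self (θ.map_cstarMatrix_nonneg' k M hM)
    have hent : ∀ i j, H.ip e (θ (M i j) e) = ∑ r, H.ip (R r i e) (R r j e) := fun i j => by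
      have h1 : θ (M i j) = ∑ r, star (R r i) * R r j := by
        have := congrArg (fun M : CStarMatrix (Fin k) (Fin k) (Adj H) => M i j) hR
        refine this.trans ?_
        simp [CStarMatrix.mul_apply, CStarMatrix.star_apply]
      rw [h1, map_sum, sum_apply, map_sum]
      exact Finset.sum_congr rfl fun r _ => by rw [← Adj.ip_star]; rfl
    refine matrix_nonneg_of_sandwich _ (fun i j => ?_) fun b => ?_
    · change star (H.ip e (θ (M i j) e)) = H.ip e (θ (M j i) e)
      rw [hent, hent, star_sum]
      exact Finset.sum_congr rfl fun r _ => H.star_ip _ _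
    · have h2 : 0 ≤ ∑ r, H.ip (∑ i, H.ract (b i) (R r i e)) (∑ j, H.ract (b j) (R r j e)) :=
        Finset.sum_nonneg fun r _ => H.ip_self_nonneg _
      refine h2.trans (le_of_eq ?_)
      change _ = ∑ i, ∑ j, star (b i) * H.ip e (θ (M i j) e) * b j
      simp only [hent, map_sum, LinearMap.sum_apply, H.ip_ract, H.ract_ip, Finset.mul_sum,
        Finset.sum_mul]
      rw [Finset.sum_comm_cycle]
      exact Finset.sum_congr rfl fun i _ => Finset.sum_comm

variable (η : A →CP MatrixAlgebra A I)

/-- The diagonal entry `η_ii : A → A`, `η_ii(a) = ⟨δ_i ⊗ 1 | η(a) (δ_i ⊗ 1)⟩`. -/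
def etaDiag (i : I) : A →CP A := compress η (stdVec A i)

variable (i₀ : I)

/-- `T = (A ⊗_η (A ⊗ B(ℓ²(I)))) ◁ (1 ⊗ e_{i₀ i₀})`, with the `A`-valued inner product
`(1 ⊗ Tr)(⟨ξ | ζ⟩)`; the trace is just the `(i₀, i₀)` entry here. -/
def covT : Correspondence A A := cornerCorrespondence (ip_stdVec_self A i₀) (cpTensor η)

/-- `ξ_i = [1 ⊗ (1 ⊗ e_{i i₀})] ∈ T`. -/
def covXi (i : I) : covT η i₀ :=
  (⟨cpTmul η 1 (matrixUnit A i i₀),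
    (mem_cornerSubmodule (ip_stdVec_self A i₀) _ _).2 <| by
      refine ((preCpTensor η).ract_cls _ _).trans (congrArg (preCpTensor η).cls ?_)
      change (1 : A) ⊗ₜ[ℂ] (matrixUnit A i i₀ * matrixUnit A i₀ i₀) =
        (1 : A) ⊗ₜ[ℂ] (matrixUnit A i i₀)
      exact congrArg _ (rankOne_mul_self (ip_stdVec_self A i₀) _)⟩ :
    cornerSubmodule (cpTensor η).toHilbertModule (stdVec A i₀))

/-- The algebra `Φ̂(A, η) = C*(A ∪ {X_i : i ∈ I})`. -/
abbrev PhiHat : Type u := SemicircularAlgebra (covXi η i₀)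

end Covariance

end

end CStarCorr

open scoped CStarAlgebra
open CStarCorr CStarCorr.SemicircularAlgebra

/-!
The map `x Ω ↦ x 1̂` preserves inner products, since `E(x* y) = ⟨x 1̂ | y 1̂⟩`, so everything rests on
the density of `Φ̂ 1̂` in the Fock space (`denseRange_toFock`). Its closure contains `A 1̂ = T^{⊠ 0}`.
If it contains all vectors of degree at most `d` and `ζ` has degree `d`, then it contains
`ξ_i ⊠ ζ = X_i ζ - ℓ(ξ_i)* ζ`, as `ℓ(ξ_i)* ζ` has degree `d - 1`; applying this to `b ▷ ζ` in place
of `ζ` and acting by `a`, it contains `(a ▷ ξ_i ◁ b) ⊠ ζ = a ▷ (ξ_i ⊠ (b ▷ ζ))`. The vectors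
`a ▷ ξ_i ◁ b` span a dense subspace of `T` (`isGenerating_covXi`): `T` is spanned by the classes
`[a ⊗ (v ⊗ δ_{i₀}^*)]` with `v` in `ℓ²(I) ⊗ A`, and for `v = δ_i ⊗ b` this class is
`a ▷ ξ_i ◁ b`. So `T^{⊠ (d + 1)}` is contained in the closure as well.

For the other isomorphisms, a correspondence with a cyclic vector `x` is determined by the map
`a ↦ ⟨x | a ▷ x⟩` (`nonempty_iso_of_isCyclic`). The cyclic vectors `X_i Ω`, `ξ_i` and
`[1 ⊗ 1] ∈ A ⊗_{η_ii} A` have the same such map, namely `η_ii`, because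
`X_i 1̂ = ξ_i ⊠ 1` (`ip_gen_lact_gen`, `ip_covXi_lact`).
-/

namespace CStarCorr

noncomputable section

variable {A B : Type u} [CStarAlgebra A] [PartialOrder A] [StarOrderedRing A] [CStarAlgebra B]

/-! ### Density -/

lemma PreHilbertModule.mem_of_forall_cls_mem (P : PreHilbertModule A)
    {K : Submodule ℂ P.toHilbertModule} (hK : IsClosed (K : Set P.toHilbertModule))
    (h : ∀ x, P.cls x ∈ K) (z : P.toHilbertModule) : z ∈ K :=
  P.denseRange_cls.induction_on (p := (· ∈ K)) z hK h

lemma correspondenceSum_mem_of_forall_sumIncl_mem {ι : Type} (X : ι → Correspondence B A)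
    {K : Submodule ℂ (correspondenceSum X)} (hK : IsClosed (K : Set (correspondenceSum X)))
    (h : ∀ i x, sumIncl X i x ∈ K) (z : correspondenceSum X) : z ∈ K := by
  classical
  refine PreHilbertModule.mem_of_forall_cls_mem _ hK (fun x => ?_) z
  induction x using DirectSum.induction_on with
  | zero => exact (map_zero (preCorrespondenceSum X).cls).symm ▸ K.zero_mem
  | add x y hx hy => exact (map_add (preCorrespondenceSum X).cls x y).symm ▸ K.add_mem hx hy
  | of i x => exact sumIncl_eq X i x ▸ h i x

lemma interiorTensor_mem_of_forall_boxTmul_mem {D : Type u} [CStarAlgebra D] [PartialOrder D]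
    [StarOrderedRing D] (X : Correspondence B D) (Y : Correspondence D A)
    {K : Submodule ℂ (interiorTensor X Y)} (hK : IsClosed (K : Set (interiorTensor X Y)))
    (h : ∀ x y, boxTmul X Y x y ∈ K) (z : interiorTensor X Y) : z ∈ K := by
  refine PreHilbertModule.mem_of_forall_cls_mem _ hK (fun x => ?_) z
  induction x using TensorProduct.induction_on with
  | zero => exact (map_zero (preInteriorTensor X Y).cls).symm ▸ K.zero_mem
  | add x y hx hy => exact (map_add (preInteriorTensor X Y).cls x y).symm ▸ K.add_mem hx hy
  | tmul x y => exact h x y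

lemma cpTensor_mem_of_forall_cpTmul_mem {D : Type u} [CStarAlgebra D] [PartialOrder D]
    [StarOrderedRing D] (θ : A →CP D)
    {K : Submodule ℂ (cpTensor θ)} (hK : IsClosed (K : Set (cpTensor θ)))
    (h : ∀ a d, cpTmul θ a d ∈ K) (z : cpTensor θ) : z ∈ K := by
  refine PreHilbertModule.mem_of_forall_cls_mem _ hK (fun x => ?_) z
  induction x using TensorProduct.induction_on with
  | zero => exact (map_zero (preCpTensor θ).cls).symm ▸ K.zero_mem
  | add x y hx hy => exact (map_add (preCpTensor θ).cls x y).symm ▸ K.add_mem hx hy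
  | tmul x y => exact h x y

lemma HilbertModule.continuous_ract_left (E : HilbertModule A) (x : E) :
    Continuous fun a => E.ract a x :=
  let f : A →ₗ[ℂ] E :=
    { toFun := fun a => E.ract a x
      map_add' := E.ract_add x
      map_smul' := E.ract_smul x }
  (f.mkContinuous ‖x‖ fun a => by rw [mul_comm]; exact E.norm_ract_le x a).continuous

/-! ### Cyclic vectors -/

namespace Correspondence

variable {X Y : Correspondence B A}

/-- Two densely defined maps with the same inner products and compatible bimodule structures
induce an isomorphism of correspondences. -/
lemma exists_iso_of_denseRange {V : Type*} [AddCommGroup V] [Module ℂ V]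
    (f : V →ₗ[ℂ] X) (g : V →ₗ[ℂ] Y) (hf : DenseRange f) (hg : DenseRange g)
    (hip : ∀ v w, Y.ip (g v) (g w) = X.ip (f v) (f w))
    (hl : ∀ b v, ∃ v', f v' = X.lact b (f v) ∧ g v' = Y.lact b (g v))
    (hr : ∀ a v, ∃ v', f v' = X.ract a (f v) ∧ g v' = Y.ract a (g v)) :
    ∃ U : X.Iso Y, ∀ v, U.toEquiv (f v) = g v := by
  have hnorm : ∀ v, ‖g (LinearEquiv.refl ℂ V v)‖ = ‖f v‖ := fun v => by
    rw [LinearEquiv.refl_apply, ← sq_eq_sq₀ (norm_nonneg _) (norm_nonneg _), X.norm_sq,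
      Y.norm_sq, hip]
  let U : X ≃ₗᵢ[ℂ] Y := (LinearEquiv.refl ℂ V).extendOfIsometry f g hf hg hnorm
  have hU : ∀ v, U (f v) = g v := (LinearEquiv.refl ℂ V).extendOfIsometry_eq f g hf hg hnorm
  refine ⟨⟨U, fun x y => ?_, fun b x => ?_, fun a x => ?_⟩, hU⟩
  · refine hf.induction_on₂ (p := fun x y => Y.ip (U x) (U y) = X.ip x y)
      (isClosed_eq (Y.continuous_ip' (by fun_prop) (by fun_prop))
        (X.continuous_ip' (by fun_prop) (by fun_prop))) (fun v w => ?_) x y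
    rw [hU, hU, hip]
  · refine hf.induction_on (p := fun x => U (X.lact b x) = Y.lact b (U x)) x
      (isClosed_eq (U.continuous.comp (X.lact b).continuous_apply)
        ((Y.lact b).continuous_apply.comp U.continuous)) fun v => ?_
    obtain ⟨v', h1, h2⟩ := hl b v
    rw [← h1, hU, hU, h2]
  · refine hf.induction_on (p := fun x => U (X.ract a x) = Y.ract a (U x)) x
      (isClosed_eq (U.continuous.comp (X.continuous_ract a))
        ((Y.continuous_ract a).comp U.continuous)) fun v => ?_
    obtain ⟨v', h1, h2⟩ := hr a v
    rw [← h1, hU, hU, h2]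

/-- The map `b ⊗ a ↦ b ▷ x ◁ a` on the algebraic tensor product. -/
def orbitMap (x : X) : B ⊗[ℂ] A →ₗ[ℂ] X :=
  TensorProduct.lift <| LinearMap.mk₂ ℂ (fun b a => X.lact b (X.ract a x))
    (fun b b' a => by rw [map_add, Adj.add_apply])
    (fun c b a => by rw [map_smul, Adj.smul_apply])
    (fun b a a' => by rw [X.ract_add, map_add])
    (fun c b a => by rw [X.ract_smul, map_smul])

lemma orbitMap_tmul (x : X) (b : B) (a : A) :
    orbitMap x (b ⊗ₜ a) = X.lact b (X.ract a x) := rfl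

lemma lact_orbitMap (x : X) (b : B) (v : B ⊗[ℂ] A) :
    X.lact b (orbitMap x v) = orbitMap x ((LinearMap.mulLeft ℂ b).rTensor A v) := by
  induction v using TensorProduct.induction_on with
  | zero => simp only [map_zero]
  | add v w hv hw => simp only [map_add, hv, hw]
  | tmul b' a => rw [LinearMap.rTensor_tmul, orbitMap_tmul, orbitMap_tmul,
      LinearMap.mulLeft_apply, map_mul, Adj.mul_apply]

lemma ract_orbitMap (x : X) (a : A) (v : B ⊗[ℂ] A) :
    X.ract a (orbitMap x v) = orbitMap x ((LinearMap.mulRight ℂ a).lTensor B v) := by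
  induction v using TensorProduct.induction_on with
  | zero => simp only [map_zero]
  | add v w hv hw => simp only [map_add, hv, hw]
  | tmul b a' => rw [LinearMap.lTensor_tmul, orbitMap_tmul, orbitMap_tmul,
      LinearMap.mulRight_apply, ← X.lact_ract, X.ract_mul]

lemma ip_lact_ract (x : X) (b b' : B) (a a' : A) :
    X.ip (X.lact b (X.ract a x)) (X.lact b' (X.ract a' x)) =
      star a * X.ip x (X.lact (star b * b') x) * a' := by
  rw [X.ip_lact, X.ract_ip, X.lact_ract, X.lact_ract, X.ip_ract, map_mul, Adj.mul_apply, mul_assoc]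

variable (X) in
/-- A vector is cyclic if `B ▷ x ◁ A` spans a dense subspace. -/
def IsCyclic (x : X) : Prop := DenseRange (orbitMap x)

/-- A correspondence with a cyclic vector `x` is determined by the map `b ↦ ⟨x | b ▷ x⟩`. -/
lemma nonempty_iso_of_isCyclic {x : X} {y : Y} (hx : X.IsCyclic x) (hy : Y.IsCyclic y)
    (h : ∀ b, Y.ip y (Y.lact b y) = X.ip x (X.lact b x)) : Nonempty (X.Iso Y) := by
  obtain ⟨U, -⟩ := exists_iso_of_denseRange (orbitMap x) (orbitMap y) hx hy
    (fun v w => by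
      induction v using TensorProduct.induction_on with
      | zero => simp only [map_zero, LinearMap.zero_apply]
      | add v v' hv hv' => simp only [map_add, LinearMap.add_apply, hv, hv']
      | tmul b a =>
        induction w using TensorProduct.induction_on with
        | zero => simp only [map_zero]
        | add w w' hw hw' => simp only [map_add, hw, hw']
        | tmul b' a' =>
          rw [orbitMap_tmul, orbitMap_tmul, orbitMap_tmul, orbitMap_tmul, ip_lact_ract,
            ip_lact_ract, h])
    (fun b v => ⟨_, (lact_orbitMap x b v).symm, (lact_orbitMap y b v).symm⟩)
    (fun a v => ⟨_, (ract_orbitMap x a v).symm, (ract_orbitMap y a v).symm⟩)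
  exact ⟨U⟩

lemma range_orbitMap (x : X) :
    LinearMap.range (orbitMap x) =
      Submodule.span ℂ {y | ∃ b a, y = X.lact b (X.ract a x)} := by
  rw [LinearMap.range_eq_map, ← TensorProduct.span_tmul_eq_top, Submodule.map_span]
  congr 1
  ext y
  constructor
  · rintro ⟨_, ⟨b, a, rfl⟩, rfl⟩
    exact ⟨b, a, rfl⟩
  · rintro ⟨b, a, rfl⟩
    exact ⟨_, ⟨b, a, rfl⟩, rfl⟩

end Correspondence

open Correspondence

lemma self_mem_generatedSubmodule (X : Correspondence B A) (x : X) :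
    x ∈ generatedSubmodule X x :=
  Submodule.le_topologicalClosure _ <| Submodule.subset_span
    ⟨1, 1, by rw [map_one, X.ract_one, Adj.one_apply]⟩

lemma ip_lact_generated (X : Correspondence B A) (x : X) (b : B)
    (hx : x ∈ generatedSubmodule X x) :
    (generated X x).ip (⟨x, hx⟩ : generatedSubmodule X x)
      ((generated X x).lact b (⟨x, hx⟩ : generatedSubmodule X x)) = X.ip x (X.lact b x) := rfl

lemma isCyclic_generated (X : Correspondence B A) (x : X) (hx : x ∈ generatedSubmodule X x) :
    (generated X x).IsCyclic (⟨x, hx⟩ : generatedSubmodule X x) := by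
  let f : B ⊗[ℂ] A →ₗ[ℂ] generatedSubmodule X x :=
    orbitMap (X := generated X x) (⟨x, hx⟩ : generatedSubmodule X x)
  have hcoe : ∀ v, (f v : X) = orbitMap x v := fun v => by
    induction v using TensorProduct.induction_on with
    | zero => rw [map_zero, map_zero]; rfl
    | add v w hv hw => rw [map_add, map_add, Submodule.coe_add, hv, hw]
    | tmul b a => rfl
  have hf : DenseRange f := fun y => by
    rw [closure_subtype]
    have hy : (y : X) ∈ closure (Submodule.span ℂ {y | ∃ b a, y = X.lact b (X.ract a x)} : Set X) :=
      y.2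
    rw [← range_orbitMap] at hy
    refine closure_mono ?_ hy
    rintro _ ⟨v, rfl⟩
    exact ⟨f v, ⟨v, rfl⟩, hcoe v⟩
  exact hf

lemma ract_cpTmul {D : Type u} [CStarAlgebra D] [PartialOrder D] [StarOrderedRing D]
    (θ : A →CP D) (a : A) (d d' : D) :
    (cpTensor θ).ract d' (cpTmul θ a d) = cpTmul θ a (d * d') :=
  (preCpTensor θ).ract_cls _ _

lemma lact_cpTmul {D : Type u} [CStarAlgebra D] [PartialOrder D] [StarOrderedRing D]
    (θ : A →CP D) (a a' : A) (d : D) :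
    (cpTensor θ).lact a' (cpTmul θ a d) = cpTmul θ (a' * a) d :=
  (preCpTensor θ).lact_cls _ _

lemma ip_cpTmul {D : Type u} [CStarAlgebra D] [PartialOrder D] [StarOrderedRing D]
    (θ : A →CP D) (a a' : A) (d d' : D) :
    (cpTensor θ).ip (cpTmul θ a d) (cpTmul θ a' d') = star d * (θ (star a * a') * d') :=
  (preCpTensor θ).ip_cls _ _

lemma isCyclic_cpTmul_one (θ : A →CP A) : (cpTensor θ).IsCyclic (cpTmul θ 1 1) := fun z =>
  cpTensor_mem_of_forall_cpTmul_mem θ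
    (K := (LinearMap.range (orbitMap (X := cpTensor θ) (cpTmul θ 1 1))).topologicalClosure)
    (Submodule.isClosed_topologicalClosure _)
    (fun a d => Submodule.le_topologicalClosure _ ⟨a ⊗ₜ d, by
      rw [orbitMap_tmul, ract_cpTmul, lact_cpTmul, one_mul, mul_one]⟩) z

/-! ### The vectors `ξ_i` generate `T` -/

/-- The family `ξ_i` generates the correspondence `T` if `A ▷ ξ_i ◁ A`, `i ∈ I`, jointly span a
dense subspace. This is encoded as an induction principle: every closed subspace that contains all
`a ▷ ξ_i ◁ b` is everything. -/
def IsGenerating {T : Correspondence A A} {I : Type} (ξ : I → T) : Prop :=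
  ∀ K : Submodule ℂ T, IsClosed (K : Set T) →
    (∀ i a b, T.lact a (T.ract b (ξ i)) ∈ K) → ∀ z, z ∈ K

section Covariance

variable {I : Type} (η : A →CP MatrixAlgebra A I) (i₀ : I)

lemma stdModule_mem_of_forall_ract_stdVec_mem {K : Submodule ℂ (stdModule A I)}
    (hK : IsClosed (K : Set (stdModule A I)))
    (h : ∀ i a, (stdModule A I).ract a (stdVec A i) ∈ K) (z : stdModule A I) : z ∈ K := by
  refine correspondenceSum_mem_of_forall_sumIncl_mem _ hK (fun i a => ?_) z
  have h1 : (stdModule A I).ract a (stdVec A i) =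
      sumIncl (fun _ : I => Correspondence.self A) i a :=
    (ract_sumIncl (fun _ : I => Correspondence.self A) i (1 : A) a).trans
      (congrArg (sumIncl (fun _ : I => Correspondence.self A) i) (one_mul (M := A) a))
  exact h1 ▸ h i a

lemma rankOne_add_left (H : HilbertModule A) (x y e : H) :
    rankOne H (x + y) e = rankOne H x e + rankOne H y e := Adj.ext fun z => by
  rw [Adj.add_apply, rankOne_apply, rankOne_apply, rankOne_apply, map_add]

lemma rankOne_smul_left (H : HilbertModule A) (c : ℂ) (x e : H) :
    rankOne H (c • x) e = c • rankOne H x e := Adj.ext fun z => by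
  rw [Adj.smul_apply, rankOne_apply, rankOne_apply, map_smul]

lemma continuous_rankOne_left (H : HilbertModule A) (e : H) :
    Continuous fun x => rankOne H x e := by
  let f : H →ₗ[ℂ] Adj H :=
    { toFun := fun x => rankOne H x e
      map_add' := fun x y => rankOne_add_left H x y e
      map_smul' := fun c x => rankOne_smul_left H c x e }
  refine (f.mkContinuous ‖e‖ fun x => ?_).continuous
  refine ContinuousLinearMap.opNorm_le_bound _ (by positivity) fun z => ?_
  refine (H.norm_ract_le x _).trans ?_
  calc ‖H.ip e z‖ * ‖x‖ ≤ ‖e‖ * ‖z‖ * ‖x‖ := by gcongr; exact H.norm_ip_le e z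
    _ = _ := by ring

/-- The element `[a ⊗ (v ⊗ δ_{i₀}^*)]` of `T`, as a function of the column `v`. -/
def covColumn (a : A) : stdModule A I →ₗ[ℂ] covT η i₀ where
  toFun v := (⟨(cpTensor η).ract (rankOne _ v (stdVec A i₀)) (cpTmul η a 1), by
    rw [mem_cornerSubmodule (ip_stdVec_self A i₀), ← (cpTensor η).ract_mul,
      rankOne_mul_self (ip_stdVec_self A i₀)]⟩ :
    cornerSubmodule (cpTensor η).toHilbertModule (stdVec A i₀))
  map_add' v w := Subtype.ext <| by
    change (cpTensor η).ract _ _ = (cpTensor η).ract _ _ + (cpTensor η).ract _ _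
    rw [← (cpTensor η).ract_add, ← rankOne_add_left]
  map_smul' c v := Subtype.ext <| by
    change (cpTensor η).ract _ _ = c • (cpTensor η).ract _ _
    rw [← (cpTensor η).ract_smul, ← rankOne_smul_left]

lemma continuous_covColumn (a : A) : Continuous (covColumn η i₀ a) :=
  (((cpTensor η).continuous_ract_left _).comp
    (continuous_rankOne_left _ (stdVec A i₀))).subtype_mk _

lemma covColumn_ract_stdVec (a b : A) (i : I) :
    covColumn η i₀ a ((stdModule A I).ract b (stdVec A i)) =
      (covT η i₀).lact a ((covT η i₀).ract b (covXi η i₀ i)) := Subtype.ext <| by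
  change (cpTensor η).ract _ (cpTmul η a 1) =
    (cpTensor η).lact a ((cpTensor η).ract (rankOne _ _ _) (cpTmul η 1 (matrixUnit A i i₀)))
  rw [ract_cpTmul, ract_cpTmul, lact_cpTmul, one_mul, mul_one, matrixUnit, rankOne_mul_rankOne,
    (stdModule A I).ip_ract, ip_stdVec_self, one_mul]

/-- The classes `[a ⊗ (v ⊗ δ_{i₀}^*)]` span a dense subspace of `T`, depend continuously on
`v ∈ ℓ²(I) ⊗ A`, and equal `a ▷ ξ_i ◁ b` for `v = δ_i ⊗ b`. -/
lemma isGenerating_covXi : IsGenerating (covXi η i₀) := by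
  intro K hK h z
  have hcol : ∀ a v, covColumn η i₀ a v ∈ K := fun a v =>
    stdModule_mem_of_forall_ract_stdVec_mem (K := K.comap (covColumn η i₀ a))
      (hK.preimage (continuous_covColumn η i₀ a))
      (fun i b => by
        rw [Submodule.mem_comap, covColumn_ract_stdVec]
        exact h i a b) v
  -- The projection of `A ⊗_η C` onto `T`.
  let p := rankOne (stdModule A I).toHilbertModule (stdVec A i₀) (stdVec A i₀)
  let P : cpTensor η →ₗ[ℂ] covT η i₀ :=
    ((cpTensor η).ract p).codRestrict
      (cornerSubmodule (cpTensor η).toHilbertModule (stdVec A i₀)) fun x => ⟨x, rfl⟩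
  have hP : Continuous P := ((cpTensor η).continuous_ract p).subtype_mk _
  have hPK : ∀ x, P x ∈ K := fun x =>
    cpTensor_mem_of_forall_cpTmul_mem η (K := K.comap P) (hK.preimage hP) (fun a c => by
      have : P (cpTmul η a c) = covColumn η i₀ a (c (stdVec A i₀)) := Subtype.ext <| by
        change (cpTensor η).ract p (cpTmul η a c) = (cpTensor η).ract _ (cpTmul η a 1)
        rw [ract_cpTmul, ract_cpTmul, one_mul]
        refine congrArg (cpTmul η a) (Adj.ext fun z => ?_)
        rw [Adj.mul_apply, rankOne_apply, rankOne_apply, Adj.apply_ract]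
      rw [Submodule.mem_comap, this]
      exact hcol _ _) x
  have hz : P z.1 = z := Subtype.ext ((mem_cornerSubmodule (ip_stdVec_self A i₀) _ _).1 z.2)
  exact hz ▸ hPK z.1

/-- The moments of `ξ_i` are those of the cyclic vector `[1 ⊗ 1]` of `A ⊗_{η_ii} A`. -/
lemma ip_covXi_lact (i : I) (a : A) :
    (covT η i₀).ip (covXi η i₀ i) ((covT η i₀).lact a (covXi η i₀ i)) = etaDiag η i a := by
  change (stdModule A I).ip (stdVec A i₀) ((cpTensor η).ip (cpTmul η 1 (matrixUnit A i i₀))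
    ((cpTensor η).lact a (cpTmul η 1 (matrixUnit A i i₀))) (stdVec A i₀)) =
    (stdModule A I).ip (stdVec A i) (η a (stdVec A i))
  have h : matrixUnit A i i₀ (stdVec A i₀) = stdVec A i := by
    rw [matrixUnit, rankOne_apply, ip_stdVec_self, (stdModule A I).ract_one]
  rw [lact_cpTmul, ip_cpTmul, Adj.mul_apply, Adj.ip_star, Adj.mul_apply, h, star_one, one_mul,
    mul_one]

end Covariance

/-! ### Cyclicity of the vacuum -/

section Fock

variable (T : Correspondence A A)

/-- The inclusion of `T^{⊠ d}` into the Fock space, as a linear map. -/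
def fockIncl (d : ℕ) : tensorPow T d →ₗ[ℂ] fock T :=
  (preCorrespondenceSum (tensorPow T)).cls ∘ₗ
    (DirectSum.lof ℂ ℕ (fun d => (tensorPow T d).carrier) d :
      tensorPow T d →ₗ[ℂ] (preCorrespondenceSum (tensorPow T)).carrier)

lemma sumIncl_eq_fockIncl (d : ℕ) (x : tensorPow T d) :
    sumIncl (tensorPow T) d x = fockIncl T d x := sumIncl_eq (tensorPow T) d x

lemma vacuum_eq_fockIncl : vacuum T = fockIncl T 0 (onePow T) := sumIncl_eq_fockIncl T 0 _

lemma ip_fockIncl (d : ℕ) (x y : tensorPow T d) :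
    (fock T).ip (fockIncl T d x) (fockIncl T d y) = (tensorPow T d).ip x y := by
  rw [← sumIncl_eq_fockIncl, ← sumIncl_eq_fockIncl]
  exact ip_sumIncl_self (tensorPow T) d x y

lemma lact_fockIncl (d : ℕ) (x : tensorPow T d) (a : A) :
    (fock T).lact a (fockIncl T d x) = fockIncl T d ((tensorPow T d).lact a x) := by
  rw [← sumIncl_eq_fockIncl, ← sumIncl_eq_fockIncl]
  exact lact_sumIncl (tensorPow T) d x a

lemma continuous_fockIncl (d : ℕ) : Continuous (fockIncl T d) := by
  refine ((fockIncl T d).mkContinuous 1 fun x => le_of_sq_le_sq ?_ (by positivity)).continuous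
  rw [HilbertModule.norm_sq, ip_fockIncl, one_mul, HilbertModule.norm_sq]

lemma lact_vacuum_eq_fockIncl (a : A) :
    (fock T).lact a (vacuum T) = fockIncl T 0 a := by
  rw [vacuum_eq_fockIncl, lact_fockIncl]
  exact congrArg (fockIncl T 0) (mul_one a)

lemma creation_fockIncl (ξ : T) (d : ℕ) (x : tensorPow T d) :
    creation T ξ (fockIncl T d x) = fockIncl T (d + 1) (raise T ξ d x) :=
  ((preCorrespondenceSum (tensorPow T)).extendAdj_cls _ _ _ _ _).trans
    (congrArg (preCorrespondenceSum (tensorPow T)).cls (creationAlg_lof T ξ d x))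

lemma star_creation_cls (ξ : T) (y : preCorrespondenceSum (tensorPow T)) :
    (star (creation T ξ)) ((preCorrespondenceSum (tensorPow T)).cls y) =
      (preCorrespondenceSum (tensorPow T)).cls (annihilationPre T ξ y) := by
  refine (fock T).ext_ip fun z => (Adj.ip_star (creation T ξ) z _).trans ?_
  refine (preCorrespondenceSum (tensorPow T)).denseRange_cls.induction_on
    (p := fun z => (fock T).ip (creation T ξ z) _ = (fock T).ip z _) z
    (isClosed_eq ((fock T).continuous_ip' (creation T ξ).continuous_apply continuous_const)
      ((fock T).continuous_ip' continuous_id continuous_const)) fun x => ?_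
  have h : creation T ξ ((preCorrespondenceSum (tensorPow T)).cls x) =
      (preCorrespondenceSum (tensorPow T)).cls (creationPre T ξ x) :=
    PreHilbertModule.extendAdj_cls _ _ _ _ _ x
  exact (congrArg (fun w => (fock T).ip w _) h).trans
    (((preCorrespondenceSum (tensorPow T)).ip_cls _ _).trans
    ((form_creationPre T ξ x y).trans ((preCorrespondenceSum (tensorPow T)).ip_cls _ _).symm))

lemma star_creation_fockIncl_zero (ξ : T) (x : tensorPow T 0) :
    (star (creation T ξ)) (fockIncl T 0 x) = 0 :=
  (star_creation_cls T ξ _).trans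
    ((congrArg (preCorrespondenceSum (tensorPow T)).cls (annihilationAlg_lof_zero T ξ x)).trans
      (map_zero _))

lemma star_creation_fockIncl_succ (ξ : T) (d : ℕ) (x : tensorPow T (d + 1)) :
    (star (creation T ξ)) (fockIncl T (d + 1) x) = fockIncl T d (lower T ξ d x) :=
  (star_creation_cls T ξ _).trans
    (congrArg (preCorrespondenceSum (tensorPow T)).cls (annihilationAlg_lof_succ T ξ d x))

/-- Since `ℓ(ξ)*` kills the vacuum, `(ℓ(ξ) + ℓ(ξ)*) 1̂ = ξ ⊠ 1`. -/
lemma semicircular_vacuum (ξ : T) :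
    semicircular T ξ (vacuum T) = fockIncl T 1 (raise T ξ 0 (onePow T)) := by
  rw [semicircular, Adj.add_apply, vacuum_eq_fockIncl, creation_fockIncl,
    star_creation_fockIncl_zero, add_zero]

end Fock

section Box

variable {D L : Type u} [CStarAlgebra D] [PartialOrder D] [StarOrderedRing D] [CStarAlgebra L]
  (X : Correspondence L D) (Y : Correspondence D A)

lemma ip_boxTmul (x x' : X) (y y' : Y) :
    (interiorTensor X Y).ip (boxTmul X Y x y) (boxTmul X Y x' y') =
      Y.ip y (Y.lact (X.ip x x') y') :=
  (preInteriorTensor X Y).ip_cls _ _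

lemma lact_boxTmul (b : L) (x : X) (y : Y) :
    (interiorTensor X Y).lact b (boxTmul X Y x y) = boxTmul X Y (X.lact b x) y :=
  (preInteriorTensor X Y).lact_cls _ _

/-- Interior tensor products are balanced. -/
lemma boxTmul_ract (x : X) (d : D) (y : Y) :
    boxTmul X Y (X.ract d x) y = boxTmul X Y x (Y.lact d y) := by
  rw [← sub_eq_zero, ← norm_eq_zero, ← sq_eq_zero_iff, (interiorTensor X Y).norm_sq]
  simp only [map_sub, LinearMap.sub_apply, ip_boxTmul]
  have h : ∀ (a b : D) (z : Y), Y.lact (a * b) z = Y.lact a (Y.lact b z) := fun a b z => by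
    rw [map_mul, Adj.mul_apply]
  simp only [X.ract_ip, X.ip_ract, h, ← Y.ip_lact, sub_self, norm_zero]

/-- The map `x ↦ x ⊠ y`. -/
def boxRight (y : Y) : X →ₗ[ℂ] interiorTensor X Y :=
  (preInteriorTensor X Y).cls ∘ₗ
    ((TensorProduct.mk ℂ X.carrier Y.carrier).flip y :
      X.carrier →ₗ[ℂ] (preInteriorTensor X Y).carrier)

lemma boxRight_apply (x : X) (y : Y) : boxRight X Y y x = boxTmul X Y x y := rfl

lemma continuous_boxRight (y : Y) : Continuous (boxRight X Y y) := by
  refine ((boxRight X Y y).mkContinuous ‖y‖ fun x => ?_).continuous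
  refine le_of_sq_le_sq ?_ (by positivity)
  rw [boxRight_apply, HilbertModule.norm_sq, ip_boxTmul, mul_pow, X.norm_sq]
  calc _ ≤ ‖y‖ * ‖Y.lact (X.ip x x) y‖ := Y.norm_ip_le _ _
    _ ≤ ‖y‖ * (‖Y.lact (X.ip x x)‖ * ‖y‖) := by
        gcongr; exact (Adj.toCLM (Y.lact (X.ip x x))).le_opNorm y
    _ ≤ ‖y‖ * (‖X.ip x x‖ * ‖y‖) := by
        gcongr; exact NonUnitalStarAlgHom.norm_apply_le Y.lact _
    _ = _ := by ring

end Box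

section Vacuum

variable {T : Correspondence A A} {I : Type} (ξ : I → T)

/-- A closed subspace of the Fock space is everything if it contains the vacuum and is invariant
under `A` and all `ℓ(ξ_i) + ℓ(ξ_i)*`, where the `ξ_i` generate `T`. -/
lemma fock_mem_of_semicircular_invariant (hξ : IsGenerating ξ)
    {K : Submodule ℂ (fock T)} (hK : IsClosed (K : Set (fock T))) (hvac : vacuum T ∈ K)
    (hA : ∀ a, ∀ z ∈ K, (fock T).lact a z ∈ K)
    (hX : ∀ i, ∀ z ∈ K, semicircular T (ξ i) z ∈ K) (z : fock T) : z ∈ K := by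
  have hdeg : ∀ d x, fockIncl T d x ∈ K := fun d => by
    induction d using Nat.strong_induction_on with
    | _ d ih =>
    rcases d with _ | d
    · exact fun a => lact_vacuum_eq_fockIncl T a ▸ hA a _ hvac
    -- `ℓ(ξ_i)ζ = X_i ζ - ℓ(ξ_i)* ζ`, and `ℓ(ξ_i)* ζ` has degree `d - 1` if `ζ` has degree `d`.
    have hcr : ∀ i y, creation T (ξ i) (fockIncl T d y) ∈ K := fun i y => by
      have h1 := hX i _ (ih d (Nat.lt_succ_self d) y)
      have h2 : (star (creation T (ξ i))) (fockIncl T d y) ∈ K := by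
        rcases d with _ | d
        · rw [star_creation_fockIncl_zero]; exact K.zero_mem
        · rw [star_creation_fockIncl_succ]; exact ih d (by omega) _
      rw [semicircular, Adj.add_apply] at h1
      exact (K.add_mem_iff_left h2).1 h1
    have hcont : Continuous (fockIncl T (d + 1)) := continuous_fockIncl T (d + 1)
    let F : interiorTensor T (tensorPow T d) →ₗ[ℂ] fock T := fockIncl T (d + 1)
    refine interiorTensor_mem_of_forall_boxTmul_mem T (tensorPow T d) (K := K.comap F)
      (hK.preimage hcont) (fun t y => ?_)
    refine hξ (K.comap (F ∘ₗ boxRight T (tensorPow T d) y))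
      (hK.preimage (hcont.comp (continuous_boxRight T (tensorPow T d) y))) (fun i a b => ?_) t
    have h3 := hA a _ (hcr i ((tensorPow T d).lact b y))
    rw [creation_fockIncl, lact_fockIncl] at h3
    have h4 : boxRight T (tensorPow T d) y (T.lact a (T.ract b (ξ i))) =
        (interiorTensor T (tensorPow T d)).lact a
          (boxTmul T (tensorPow T d) (ξ i) ((tensorPow T d).lact b y)) := by
      rw [boxRight_apply, ← lact_boxTmul, boxTmul_ract, lact_boxTmul]
    rw [Submodule.mem_comap, LinearMap.comp_apply, h4]
    exact h3
  exact correspondenceSum_mem_of_forall_sumIncl_mem (tensorPow T) (K := K) hK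
    (fun d x => (sumIncl_eq_fockIncl T d x).symm ▸ hdeg d x) z

namespace SemicircularAlgebra

/-- The map `x ↦ x 1̂`. -/
def toFock : SemicircularAlgebra ξ →ₗ[ℂ] fock T where
  toFun x := incl ξ x (vacuum T)
  map_add' x y := by rw [map_add, Adj.add_apply]
  map_smul' c x := by rw [map_smul, Adj.smul_apply]; rfl

lemma denseRange_toFock (hξ : IsGenerating ξ) : DenseRange (toFock ξ) := by
  let K := (LinearMap.range (toFock ξ)).topologicalClosure
  have hinv : ∀ x : SemicircularAlgebra ξ, ∀ z ∈ K, incl ξ x z ∈ K := fun x => by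
    have : Set.MapsTo (incl ξ x) (Set.range (toFock ξ)) (Set.range (toFock ξ)) := by
      rintro _ ⟨y, rfl⟩
      refine ⟨x * y, ?_⟩
      change incl ξ (x * y) (vacuum T) = incl ξ x (incl ξ y (vacuum T))
      rw [map_mul, Adj.mul_apply]
    exact this.closure (incl ξ x).continuous_apply
  refine fun z => fock_mem_of_semicircular_invariant ξ hξ (K := K)
    (Submodule.isClosed_topologicalClosure _) (Submodule.le_topologicalClosure _ ⟨1, ?_⟩)
    (fun a => hinv (ofA ξ a)) (fun i => hinv (gen ξ i)) z
  change incl ξ 1 (vacuum T) = vacuum T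
  rw [map_one, Adj.one_apply]

/-- By density, `x Ω ↦ x 1̂` extends to an isomorphism of the GNS correspondence onto the whole
Fock space. -/
lemma exists_gns_iso (hξ : IsGenerating ξ) :
    ∃ U : (gns ξ).Iso (fockCorrespondence ξ), ∀ x, U.toEquiv (toGns ξ x) = toFock ξ x :=
  exists_iso_of_denseRange (X := gns ξ) (Y := fockCorrespondence ξ) (toGns ξ) (toFock ξ)
    (preGns ξ).denseRange_cls (denseRange_toFock ξ hξ)
    (fun x y => ((condExp_star_mul ξ x y).symm.trans ((preGns ξ).ip_cls x y).symm))
    (fun b x => ⟨b * x, ((preGns ξ).lact_cls b x).symm, by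
      change incl ξ (b * x) (vacuum T) = incl ξ b (incl ξ x (vacuum T))
      rw [map_mul, Adj.mul_apply]⟩)
    (fun a x => ⟨x * ofA ξ a, ((preGns ξ).ract_cls a x).symm, by
      change incl ξ (x * ofA ξ a) (vacuum T) = (fock T).ract a (incl ξ x (vacuum T))
      rw [map_mul, Adj.mul_apply, ← Adj.apply_ract, ← lact_vacuum]; rfl⟩)

/-- The moments of `X_i Ω` are those of `ξ_i`, because `X_i 1̂ = ξ_i ⊠ 1`. -/
lemma ip_gen_lact_gen (i : I) (a : A) :
    (gns ξ).ip (toGns ξ (gen ξ i)) ((gns ξ).lact (ofA ξ a) (toGns ξ (gen ξ i))) =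
      T.ip (ξ i) (T.lact a (ξ i)) := by
  have h1 : (gns ξ).lact (ofA ξ a) (toGns ξ (gen ξ i)) = toGns ξ (ofA ξ a * gen ξ i) :=
    (preGns ξ).lact_cls _ _
  have h2 : incl ξ (ofA ξ a * gen ξ i) (vacuum T) =
      (fock T).lact a (semicircular T (ξ i) (vacuum T)) := by
    rw [map_mul, Adj.mul_apply]; rfl
  have h3 : incl ξ (gen ξ i) (vacuum T) = semicircular T (ξ i) (vacuum T) := rfl
  rw [h1]
  refine ((preGns ξ).ip_cls _ _).trans ((condExp_star_mul ξ _ _).trans ?_)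
  rw [h2, h3, semicircular_vacuum, lact_fockIncl, ip_fockIncl]
  refine (congrArg _ (lact_boxTmul T (tensorPow T 0) a (ξ i) (onePow T))).trans ?_
  refine (ip_boxTmul T (tensorPow T 0) _ _ _ _).trans ?_
  change star (1 : A) * (T.ip (ξ i) (T.lact a (ξ i)) * 1) = _
  rw [star_one, one_mul, mul_one]

end SemicircularAlgebra

end Vacuum

end
end CStarCorr

open scoped CStarAlgebra
open CStarCorr CStarCorr.SemicircularAlgebra
theorem mainTheorem9 {A : Type u} [CStarAlgebra A] [PartialOrder A] [StarOrderedRing A]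
    {I : Type} [Countable I] (η : A →CP MatrixAlgebra A I) (i₀ : I)
    (hE : ∀ x : PhiHat η i₀, condExp (covXi η i₀) (star x * x) = 0 → x = 0) :
    (∃ U : (gns (covXi η i₀)).Iso (fockCorrespondence (covXi η i₀)),
      ∀ x : PhiHat η i₀,
        U.toEquiv (toGns (covXi η i₀) x) = incl (covXi η i₀) x (vacuum (covT η i₀))) ∧
    ∀ i : I,
      Nonempty
        ((generated ((gns (covXi η i₀)).restrictLeft (ofA (covXi η i₀)))
            (toGns (covXi η i₀) (gen (covXi η i₀) i))).Iso
          (generated (covT η i₀) (covXi η i₀ i))) ∧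
      Nonempty
        ((generated (covT η i₀) (covXi η i₀ i)).Iso (cpTensor (etaDiag η i))) := by
  refine ⟨exists_gns_iso _ (isGenerating_covXi η i₀), fun i => ?_⟩
  have hΩ := self_mem_generatedSubmodule
    ((gns (covXi η i₀)).restrictLeft (ofA (covXi η i₀))) (toGns (covXi η i₀) (gen (covXi η i₀) i))
  have hξ := self_mem_generatedSubmodule (covT η i₀) (covXi η i₀ i)
  refine ⟨Correspondence.nonempty_iso_of_isCyclic (isCyclic_generated _ _ hΩ)
      (isCyclic_generated _ _ hξ) fun a => ?_,
    Correspondence.nonempty_iso_of_isCyclic (isCyclic_generated _ _ hξ)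
      (isCyclic_cpTmul_one (etaDiag η i)) fun a => ?_⟩
  · rw [ip_lact_generated]
    exact (ip_gen_lact_gen (covXi η i₀) i a).symm
  · rw [ip_lact_generated, ip_covXi_lact, lact_cpTmul, ip_cpTmul, star_one, one_mul, one_mul,
      mul_one, mul_one]
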